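/- Let $\Bbbk$ be a field, $R=\Bbbk[x_1,\dots,x_n]$ with its $\mathbb{Z}^n$-grading, and let $I\subseteq R$ be a monomial ideal that is invariant under all permutations of the variables. Let $P_n=\{(\lambda_1,\dots,\lambda_n)\in\mathbb{Z}^n : \lambda_1\ge\cdots\ge\lambda_n\ge 0\}$, ordered componentwise, and $|\lambda|=\lambda_1+\cdots+\lambda_n$. Let $\Bbbk=R/(x_1,\dots,x_n)$. The modules $\mathrm{Tor}_i(R/I,\Bbbk)=\mathrm{Tor}_i^R(R/I,\Bbbk)$ and $\mathrm{Ext}^i(R/I,R)=\mathrm{Ext}^i_R(R/I,R)$ are $\mathbb{Z}^n$-graded: they are the homology of $F_\bullet\otimes_R\Bbbk$ and the cohomology of $\mathrm{Hom}_R(F_\bullet,R)$, for any resolution $F_\bullet$ of $R/I$ by finitely generated $\mathbb{Z}^n$-graded free $R$-modules. For a $\mathbb{Z}^n$-graded module $M$ and $\lambda\in P_n$, write $M_{\boldsymbol a}$ for the component of degree $\boldsymbol a\in\mathbb{Z}^n$, and let $M_{\langle\lambda\rangle}$ (respectively $M_{\langle-\lambda\rangle}$) be the direct sum of the components $M_{\boldsymbol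 a}$ over all distinct rearrangements $\boldsymbol a$ of $\lambda$ (respectively of $-\lambda$). For $\lambda,\mu\in P_n$, write $\mu\gneq\lambda$ if $\mu\ge\lambda$ and $\mu\ne\lambda$. A pair $(i,\lambda)\in\{1,\dots,n\}\times P_n$ is called *extremal* in the Betti table of $R/I$ if $\mathrm{Tor}_i(R/I,\Bbbk)_{\langle\lambda\rangle}\neq 0$ and $\mathrm{Tor}_j(R/I,\Bbbk)_{\langle\mu\rangle}=0$ for all $j\ge i$ and all $\mu\in P_n$ with $\mu\gneq\lambda$ and $|\mu|-j\ge|\lambda|-i$. It is called *$\mathrm{Ext}$-extremal* if $\mathrm{Ext}^i(R/I,R)_{\langle-\lambda\rangle}\neq 0$ and $\mathrm{Ext}^j(R/I,R)_{\langle-\mu\rangle}=0$ for all $j\ge i$ and all $\mu\in P_n$ with $\mu\gneq\lambda$ and $|\mu|-j\ge|\lambda|-i$. **Proposition.** A pair $(i,\lambda)\in\{1,\dots,n\}\times P_n$ is extremal if and only if it is $\mathrm{Ext}$-extremal. Moreover, for every extremal pair $(i,\lambda)$, the extremal Betti number $\beta_{i,\lambda}=\dim_\Bbbk\mathrm{Tor}_i(R/I,\Bbbk)_{\lambda}$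 satisfies $$\beta_{i,\lambda}=\dim_{\Bbbk}\mathrm{Ext}^i(R/I,R)_{-\lambda}.$$ -/

import Mathlib

open scoped TensorProduct

noncomputable section

/-- `R = k[x_1, …, x_n]`. -/
abbrev PolyRing (k : Type*) [Field k] (n : ℕ) : Type _ := MvPolynomial (Fin n) k

section Homology

variable {k R C : Type*} [Field k] [CommRing R] [Algebra k R] [AddCommGroup C] [Module R C]
  [Module k C] [IsScalarTower k R C]

/-- The homology module `Z / B` of cycles `Z ⊆ C` modulo boundaries `B ⊆ Z`. -/
abbrev HomologyModule (Z B : Submodule R C) : Type _ := Z ⧸ B.submoduleOf Z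

/-- The subspace of `Z / B` of all classes that are represented by a cycle in `P ⊆ C`. -/
def homologyPiece (Z B : Submodule R C) (P : Submodule k C) : Submodule k (HomologyModule Z B) :=
  (P.comap (Z.subtype.restrictScalars k)).map ((B.submoduleOf Z).mkQ.restrictScalars k)

end Homology

section Grading

variable (k : Type*) [Field k] {n : ℕ}

/-- The graded piece `R_c` of `R = k[x_1, …, x_n]` for its fine `ℤ^n`-grading: the polynomials all
of whose monomials have exponent vector `c`. It is `k · x^c` if `c ≥ 0`, and `0` otherwise. -/
def polyPiece (c : Fin n → ℤ) : Submodule k (PolyRing k n) where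
  carrier := {f | ∀ m ∈ f.support, ∀ j, (m j : ℤ) = c j}
  zero_mem' := by simp
  add_mem' := by
    classical
    intro f g hf hg m hm
    rcases Finset.mem_union.mp (MvPolynomial.support_add hm) with h | h
    · exact hf m h
    · exact hg m h
  smul_mem' := by
    intro t f hf m hm
    exact hf m (MvPolynomial.support_smul hm)

/-- The graded piece of degree `a` of the `ℤ^n`-graded free module `⊕_p R(-deg p)`, whose `p`-th
basis vector has degree `deg p`. -/
def freePiece {b : ℕ} (deg : Fin b → Fin n → ℤ) (a : Fin n → ℤ) :
    Submodule k (Fin b → PolyRing k n) where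
  carrier := {x | ∀ p, x p ∈ polyPiece k (a - deg p)}
  zero_mem' := fun _ => Submodule.zero_mem _
  add_mem' := fun hx hy p => Submodule.add_mem _ (hx p) (hy p)
  smul_mem' := fun t _ hx p => Submodule.smul_mem _ t (hx p)

/-- The graded piece of degree `a` of the dual `Hom_R(F, R)` of the graded free module
`F = ⊕_p R(-deg p)`: the `R`-linear maps that send `F_c` to `R_{c + a}` for all `c`. -/
def dualPiece {b : ℕ} (deg : Fin b → Fin n → ℤ) (a : Fin n → ℤ) :
    Submodule k (Module.Dual (PolyRing k n) (Fin b → PolyRing k n)) where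
  carrier := {φ | ∀ c, ∀ x ∈ freePiece k deg c, φ x ∈ polyPiece k (c + a)}
  zero_mem' := fun _ _ _ => Submodule.zero_mem _
  add_mem' := fun hx hy c x h => Submodule.add_mem _ (hx c x h) (hy c x h)
  smul_mem' := fun t _ hx c x h => Submodule.smul_mem _ t (hx c x h)

variable {k}

/-- The graded piece of degree `a` of `R / I`. -/
def quotientPiece (I : Ideal (PolyRing k n)) (a : Fin n → ℤ) : Submodule k (PolyRing k n ⧸ I) :=
  (polyPiece k a).map (Ideal.Quotient.mkₐ k I).toLinearMap

end Grading

section Ideals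

variable {k : Type*} [Field k] {n : ℕ}

/-- `I` is generated by monomials. -/
def IsMonomialIdeal (I : Ideal (PolyRing k n)) : Prop :=
  ∃ S : Set (Fin n →₀ ℕ), I = Ideal.span ((fun m => MvPolynomial.monomial m (1 : k)) '' S)

/-- `σ(I) = I` for every permutation `σ` of the variables. -/
def IsSymmetricIdeal (I : Ideal (PolyRing k n)) : Prop :=
  ∀ σ : Equiv.Perm (Fin n), I.map (MvPolynomial.rename σ : PolyRing k n →ₐ[k] PolyRing k n) = I

/-- The ideal `(x_1, …, x_n)`, so that the `R`-module `k` is `R / (x_1, …, x_n)`. -/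
def irrelevantIdeal (k : Type*) [Field k] (n : ℕ) : Ideal (PolyRing k n) :=
  Ideal.span (Set.range MvPolynomial.X)

end Ideals

/-- A `ℤ^n`-graded resolution
`… ⟶ F_2 ⟶ F_1 ⟶ F_0 ⟶ R / I ⟶ 0` of `R / I` by finitely generated graded free modules
`F_i = ⊕_p R(-deg_i p)`, with differentials and augmentation that preserve degrees. -/
structure MultigradedFreeResolution {k : Type*} [Field k] {n : ℕ} (I : Ideal (PolyRing k n)) where
  rank : ℕ → ℕ
  deg : ∀ i, Fin (rank i) → Fin n → ℤ
  d : ∀ i, (Fin (rank (i + 1)) → PolyRing k n) →ₗ[PolyRing k n] (Fin (rank i) → PolyRing k n)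
  aug : (Fin (rank 0) → PolyRing k n) →ₗ[PolyRing k n] PolyRing k n ⧸ I
  d_graded : ∀ i a, ∀ x ∈ freePiece k (deg (i + 1)) a, d i x ∈ freePiece k (deg i) a
  aug_graded : ∀ a, ∀ x ∈ freePiece k (deg 0) a, aug x ∈ quotientPiece I a
  aug_surjective : Function.Surjective aug
  exact_zero : LinearMap.range (d 0) = LinearMap.ker aug
  exact_succ : ∀ i, LinearMap.range (d (i + 1)) = LinearMap.ker (d i)

namespace MultigradedFreeResolution

variable {k : Type*} [Field k] {n : ℕ} {I : Ideal (PolyRing k n)} (F : MultigradedFreeResolution I)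

/-- The free module `F_i`. -/
abbrev module (i : ℕ) : Type _ := Fin (F.rank i) → PolyRing k n

/-- The `R`-module `F_i ⊗_R k`. -/
abbrev torChains (i : ℕ) : Type _ :=
  F.module i ⊗[PolyRing k n] (PolyRing k n ⧸ irrelevantIdeal k n)

/-- The differential `F_{i+1} ⊗_R k ⟶ F_i ⊗_R k`. -/
def torDifferential (i : ℕ) : F.torChains (i + 1) →ₗ[PolyRing k n] F.torChains i :=
  (F.d i).rTensor (PolyRing k n ⧸ irrelevantIdeal k n)

/-- The cycles of `F ⊗_R k`. -/
def torCycles : ∀ i, Submodule (PolyRing k n) (F.torChains i)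
  | 0 => ⊤
  | i + 1 => LinearMap.ker (F.torDifferential i)

/-- The boundaries of `F ⊗_R k`. -/
def torBoundaries (i : ℕ) : Submodule (PolyRing k n) (F.torChains i) :=
  LinearMap.range (F.torDifferential i)


/-- `Tor_i(R / I, k)`, the homology of `F ⊗_R k`. -/
abbrev TorModule (i : ℕ) : Type _ :=
  HomologyModule (F.torCycles i) (F.torBoundaries i)

/-- The graded piece `(F_i ⊗_R k)_a`; here `k` is concentrated in degree `0`. -/
def torChainPiece (i : ℕ) (a : Fin n → ℤ) : Submodule k (F.torChains i) :=
  (freePiece k (F.deg i) a).map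
    (((TensorProduct.mk (PolyRing k n) (F.module i)
      (PolyRing k n ⧸ irrelevantIdeal k n)).flip 1).restrictScalars k)

/-- The graded piece `Tor_i(R / I, k)_a`: the classes of the cycles of degree `a`. -/
def torPiece (i : ℕ) (a : Fin n → ℤ) : Submodule k (F.TorModule i) :=
  homologyPiece (F.torCycles i) (F.torBoundaries i) (F.torChainPiece i a)

/-- The `R`-module `Hom_R(F_i, R)`. -/
abbrev extCochains (i : ℕ) : Type _ := Module.Dual (PolyRing k n) (F.module i)

/-- The differential `Hom_R(F_i, R) ⟶ Hom_R(F_{i+1}, R)`. -/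
def extDifferential (i : ℕ) : F.extCochains i →ₗ[PolyRing k n] F.extCochains (i + 1) :=
  (F.d i).dualMap

/-- The cocycles of `Hom_R(F, R)`. -/
def extCocycles (i : ℕ) : Submodule (PolyRing k n) (F.extCochains i) :=
  LinearMap.ker (F.extDifferential i)

/-- The coboundaries of `Hom_R(F, R)`. -/
def extCoboundaries : ∀ i, Submodule (PolyRing k n) (F.extCochains i)
  | 0 => ⊥
  | i + 1 => LinearMap.range (F.extDifferential i)

/-- `Ext^i(R / I, R)`, the cohomology of `Hom_R(F, R)`. -/
abbrev ExtModule (i : ℕ) : Type _ :=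
  HomologyModule (F.extCocycles i) (F.extCoboundaries i)

/-- The graded piece `Ext^i(R / I, R)_a`: the classes of the cocycles of degree `a`. -/
def extPiece (i : ℕ) (a : Fin n → ℤ) : Submodule k (F.ExtModule i) :=
  homologyPiece (F.extCocycles i) (F.extCoboundaries i) (dualPiece k (F.deg i) a)

/-- A vector of naturals viewed in `ℤ^n`. -/
def _root_.toIntVec (lam : Fin n → ℕ) : Fin n → ℤ := fun j => (lam j : ℤ)

/-- `Tor_i(R / I, k)_⟨λ⟩`, the sum of the pieces of degree `a` over all rearrangements `a`
of `λ`. -/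
def torOrbitPiece (i : ℕ) (lam : Fin n → ℕ) : Submodule k (F.TorModule i) :=
  ⨆ σ : Equiv.Perm (Fin n), F.torPiece i (toIntVec (lam ∘ σ))

/-- `Ext^i(R / I, R)_⟨-λ⟩`, the sum of the pieces of degree `a` over all rearrangements `a`
of `-λ`. -/
def extOrbitPiece (i : ℕ) (lam : Fin n → ℕ) : Submodule k (F.ExtModule i) :=
  ⨆ σ : Equiv.Perm (Fin n), F.extPiece i (-toIntVec (lam ∘ σ))

/-- `(i, λ)` is extremal in the Betti table of `R / I`. Partitions with `n` parts (zeros allowed)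
are the antitone maps `Fin n → ℕ`, ordered componentwise. -/
def IsExtremal (i : ℕ) (lam : Fin n → ℕ) : Prop :=
  F.torOrbitPiece i lam ≠ ⊥ ∧
    ∀ (j : ℕ) (mu : Fin n → ℕ), i ≤ j → Antitone mu → lam < mu →
      (∑ t, (lam t : ℤ)) - i ≤ (∑ t, (mu t : ℤ)) - j → F.torOrbitPiece j mu = ⊥

/-- `(i, λ)` is `Ext`-extremal. -/
def IsExtExtremal (i : ℕ) (lam : Fin n → ℕ) : Prop :=
  F.extOrbitPiece i lam ≠ ⊥ ∧
    ∀ (j : ℕ) (mu : Fin n → ℕ), i ≤ j → Antitone mu → lam < mu →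
      (∑ t, (lam t : ℤ)) - i ≤ (∑ t, (mu t : ℤ)) - j → F.extOrbitPiece j mu = ⊥

end MultigradedFreeResolution

section Existence

variable {k : Type*} [Field k] {n : ℕ}

theorem iSup_freePiece {b : ℕ} (deg : Fin b → Fin n → ℤ) : ⨆ a, freePiece k deg a = ⊤ := by
  classical
  refine eq_top_iff.mpr fun x _ => ?_
  rw [← Finset.univ_sum_single x]
  refine Submodule.sum_mem _ fun p _ => ?_
  rw [MvPolynomial.as_sum (x p), ← LinearMap.single_apply (R := PolyRing k n), map_sum]
  refine Submodule.sum_mem _ fun m _ => ?_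
  refine Submodule.mem_iSup_of_mem (fun j => (m j : ℤ) + deg p j) fun q m' hm' j => ?_
  by_cases h : q = p
  · subst h
    have h1 := MvPolynomial.support_monomial_subset
      (by simpa only [LinearMap.single_apply, Pi.single_eq_same] using hm')
    rw [Finset.mem_singleton.mp h1]
    simp
  · simp [LinearMap.single_apply, Pi.single_eq_of_ne h] at hm'

theorem eq_zero_of_sum_freePiece {b : ℕ} (deg : Fin b → Fin n → ℤ) (s : Finset (Fin n → ℤ))
    (y : (Fin n → ℤ) → Fin b → PolyRing k n) (hy : ∀ a, y a ∈ freePiece k deg a)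
    (h : ∑ a ∈ s, y a = 0) : ∀ a ∈ s, y a = 0 := by
  intro a ha
  funext p
  ext m
  by_contra hne
  have key : ∀ c, MvPolynomial.coeff m (y c p) ≠ 0 → ∀ j, c j = m j + deg p j := by
    intro c hc j
    have := hy c p m (MvPolynomial.mem_support_iff.mpr hc) j
    simp only [Pi.sub_apply] at this
    omega
  have h0 : MvPolynomial.coeff m ((∑ c ∈ s, y c) p) = 0 := by rw [h]; simp
  rw [Finset.sum_apply, MvPolynomial.coeff_sum, Finset.sum_eq_single_of_mem a ha] at h0
  · exact hne (by simpa using h0)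
  · intro c _ hca
    by_contra hc
    refine hca (funext fun j => ?_)
    rw [key c hc j, key a (by simpa using hne) j]

/-- A submodule of a graded free module that is generated by homogeneous elements. -/
def IsHomogeneousSubmodule {b : ℕ} (deg : Fin b → Fin n → ℤ)
    (N : Submodule (PolyRing k n) (Fin b → PolyRing k n)) : Prop :=
  N = Submodule.span (PolyRing k n) {x | x ∈ N ∧ ∃ a, x ∈ freePiece k deg a}

theorem isHomogeneous_ker {b c : ℕ} (deg : Fin b → Fin n → ℤ) (deg' : Fin c → Fin n → ℤ)
    (f : (Fin b → PolyRing k n) →ₗ[PolyRing k n] (Fin c → PolyRing k n))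
    (hf : ∀ a, ∀ x ∈ freePiece k deg a, f x ∈ freePiece k deg' a) :
    IsHomogeneousSubmodule deg (LinearMap.ker f) := by
  refine le_antisymm (fun x hx => ?_) (Submodule.span_le.mpr fun x hx => hx.1)
  have hxt : x ∈ ⨆ a, freePiece k deg a := by rw [iSup_freePiece]; trivial
  obtain ⟨u, hu, rfl⟩ := (Submodule.mem_iSup_iff_exists_finsupp _ _).mp hxt
  refine Submodule.sum_mem _ fun a ha => Submodule.subset_span ⟨?_, a, hu a⟩
  refine eq_zero_of_sum_freePiece deg' u.support (fun a => f (u a)) (fun a => hf a _ (hu a)) ?_ a ha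
  rw [← map_sum]
  exact hx

theorem exists_cover {b : ℕ} (deg : Fin b → Fin n → ℤ)
    (N : Submodule (PolyRing k n) (Fin b → PolyRing k n)) (hN : IsHomogeneousSubmodule deg N) :
    ∃ (c : ℕ) (deg' : Fin c → Fin n → ℤ)
      (f : (Fin c → PolyRing k n) →ₗ[PolyRing k n] (Fin b → PolyRing k n)),
      (∀ a, ∀ x ∈ freePiece k deg' a, f x ∈ freePiece k deg a) ∧ LinearMap.range f = N := by
  have hfg : N.FG := IsNoetherian.noetherian N
  rw [hN, Submodule.fg_span_iff_fg_span_finset_subset] at hfg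
  obtain ⟨s, hs, hspan⟩ := hfg
  have hdeg : ∀ p : Fin s.card, ∃ a, (s.equivFin.symm p : Fin b → PolyRing k n) ∈ freePiece k deg a :=
    fun p => (hs (s.equivFin.symm p).2).2
  choose deg' hdeg' using hdeg
  refine ⟨s.card, deg', Fintype.linearCombination (PolyRing k n)
    (fun p => (s.equivFin.symm p : Fin b → PolyRing k n)), fun a x hx => ?_, ?_⟩
  · rw [Fintype.linearCombination_apply]
    refine Submodule.sum_mem _ fun p _ q m hm j => ?_
    classical
    rw [Pi.smul_apply, smul_eq_mul] at hm
    obtain ⟨m1, h1, m2, h2, rfl⟩ := Finset.mem_add.mp (MvPolynomial.support_mul _ _ hm)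
    have e1 := hx p m1 h1 j
    have e2 := hdeg' p q m2 h2 j
    simp only [Pi.sub_apply, Finsupp.add_apply, Nat.cast_add] at e1 e2 ⊢
    omega
  · rw [Fintype.range_linearCombination, hN, hspan]
    congr 1
    ext x
    constructor
    · rintro ⟨p, rfl⟩
      exact (s.equivFin.symm p).2
    · intro hx
      exact ⟨s.equivFin ⟨x, hx⟩, by simp⟩

/-- Every monomial ideal `I` has a `ℤ^n`-graded free resolution of `R / I`. -/
theorem nonempty_multigradedFreeResolution (I : Ideal (PolyRing k n)) (hI : IsMonomialIdeal I) :
    Nonempty (MultigradedFreeResolution I) := by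
  let St : Type _ := Σ' (b : ℕ) (deg : Fin b → Fin n → ℤ)
    (N : Submodule (PolyRing k n) (Fin b → PolyRing k n)), IsHomogeneousSubmodule deg N
  have step : ∀ s : St, ∃ (t : St)
      (f : (Fin t.1 → PolyRing k n) →ₗ[PolyRing k n] (Fin s.1 → PolyRing k n)),
      (∀ a, ∀ x ∈ freePiece k t.2.1 a, f x ∈ freePiece k s.2.1 a) ∧
      LinearMap.range f = s.2.2.1 ∧ LinearMap.ker f = t.2.2.1 := by
    rintro ⟨b, deg, N, hN⟩
    obtain ⟨c, deg', f, hf, hr⟩ := exists_cover deg N hN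
    exact ⟨⟨c, deg', LinearMap.ker f, isHomogeneous_ker deg' deg f hf⟩, f, hf, hr, rfl⟩
  choose next f hf hr hk using step
  let aug : (Fin 1 → PolyRing k n) →ₗ[PolyRing k n] PolyRing k n ⧸ I :=
    I.mkQ ∘ₗ LinearMap.proj 0
  have haug : IsHomogeneousSubmodule (fun _ _ => 0) (LinearMap.ker aug) := by
    obtain ⟨S, rfl⟩ := hI
    refine le_antisymm (fun x hx => ?_) (Submodule.span_le.mpr fun x hx => hx.1)
    have hx0 : x 0 ∈ Ideal.span ((fun m => MvPolynomial.monomial m (1 : k)) '' S) := by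
      simpa [aug, Ideal.Quotient.eq_zero_iff_mem] using hx
    have hxe : x = LinearMap.pi (R := PolyRing k n)
        (fun _ : Fin 1 => (LinearMap.id : PolyRing k n →ₗ[PolyRing k n] PolyRing k n)) (x 0) := by
      funext p
      rw [Subsingleton.elim p 0]
      rfl
    rw [hxe, ← Submodule.mem_comap]
    refine Submodule.span_le.mpr ?_ hx0
    rintro _ ⟨m, hm, rfl⟩
    refine Submodule.subset_span ⟨?_, fun j => (m j : ℤ), fun q m' hm' j => ?_⟩
    · have : MvPolynomial.monomial m (1 : k) ∈
          Ideal.span ((fun m => MvPolynomial.monomial m (1 : k)) '' S) :=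
        Ideal.subset_span ⟨m, hm, rfl⟩
      exact Ideal.Quotient.eq_zero_iff_mem.mpr this
    · have h1 := MvPolynomial.support_monomial_subset hm'
      rw [Finset.mem_singleton.mp h1]
      simp
  let s : ℕ → St := fun i => Nat.rec ⟨1, fun _ _ => 0, LinearMap.ker aug, haug⟩ (fun _ t => next t) i
  refine ⟨⟨fun i => (s i).1, fun i => (s i).2.1, fun i => f (s i), aug, fun i => hf (s i), ?_, ?_,
    hr (s 0), fun i => (hr (s (i + 1))).trans (hk (s i)).symm⟩⟩
  · intro a x hx
    refine Submodule.mem_map.mpr ⟨x 0, ?_, rfl⟩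
    have h0 : x 0 ∈ polyPiece k (a - 0) := hx 0
    simpa using h0
  · intro y
    obtain ⟨r, rfl⟩ := Submodule.Quotient.mk_surjective _ y
    exact ⟨fun _ => r, rfl⟩

end Existence

end

/-!
Fix a graded free resolution `F` of `R / I`. Its differentials are determined by matrices over `k`,
the coefficients of the only monomials that can occur, and an entry of such a matrix can be nonzero
only if the degree of its row is at most the degree of its column. Since `k = R / (x_1, …, x_n)`
kills the nonconstant monomials, the degree `b` part of `F ⊗ k` is given by the block of the matrices
on the basis elements of degree exactly `b`. The degree `-a` part of `Hom(F, R)` is given by the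
transposed matrices on the basis elements of all degrees `≥ a`. Ordering these degrees filters the
second complex, with the duals of the blocks of degrees `b ≥ a` as its graded pieces. No minimality
of `F` is needed.

Hence `Ext^i_{-a}` vanishes if `Tor_i` vanishes in all degrees `≥ a`
(`exists_vecMul_eq_of_blockHomologyDim_eq_zero`, `extPiece_eq_bot`), and if `Tor_i` and `Tor_{i+1}`
vanish in all degrees `> a`, then `Ext^i_{-a}` has the dimension of `Tor_i` in degree `a`
(`rank_extPiece`). Every degree that dominates a rearrangement of a partition `λ` is a rearrangement
of a partition that dominates `λ` (`exists_antitone_rearrangement`), so that at an extremal pair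
these vanishing conditions hold for every rearrangement of `λ`. This shows that extremal pairs are
`Ext`-extremal, with equal dimensions.

For the converse, `Tor_i` vanishes for `i > n` (`torDim_eq_zero_of_le`), so only finitely many
degrees have nonzero Betti numbers, and every nonzero Betti number lies below an extremal one
(`exists_isExtremal_ge`). If `(i, λ)` is `Ext`-extremal, then some `Tor_i` is nonzero in a degree
`≥ λ`; the extremal pair above it is `Ext`-extremal as well, and therefore equals `(i, λ)`.
-/

open scoped TensorProduct

noncomputable section

/-! ### Homology of a pair of matrices, and its blocks -/

section LinearAlgebra

variable {k : Type*} [Field k]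

/-- For `A * B = 0`, the rank count for the homology in the middle detects exactness of the
transposed sequence. -/
theorem exists_vecMul_eq_of_rank_add_rank {P Q S : Type*} [Fintype P] [Fintype Q] [Fintype S]
    (A : Matrix P Q k) (B : Matrix Q S k) (hAB : A * B = 0)
    (hrank : Fintype.card Q = A.rank + B.rank) (v : Q → k) (hv : Matrix.vecMul v B = 0) :
    ∃ e, Matrix.vecMul e A = v := by
  have hle : LinearMap.range A.transpose.mulVecLin ≤ LinearMap.ker B.transpose.mulVecLin := by
    rintro _ ⟨e, rfl⟩
    simp only [LinearMap.mem_ker, Matrix.mulVecLin_apply, Matrix.mulVec_transpose,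
      Matrix.vecMul_vecMul, hAB, Matrix.vecMul_zero]
  have hker := LinearMap.finrank_range_add_finrank_ker B.transpose.mulVecLin
  have hA : Module.finrank k (LinearMap.range A.transpose.mulVecLin) = A.rank :=
    Matrix.rank_transpose A
  have hB : Module.finrank k (LinearMap.range B.transpose.mulVecLin) = B.rank :=
    Matrix.rank_transpose B
  rw [hB, Module.finrank_fintype_fun_eq_card] at hker
  have heq := Submodule.eq_of_le_of_finrank_eq hle (by omega)
  have hmem : v ∈ LinearMap.range A.transpose.mulVecLin := by
    rw [heq, LinearMap.mem_ker, Matrix.mulVecLin_apply, Matrix.mulVec_transpose, hv]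
  obtain ⟨e, he⟩ := hmem
  exact ⟨e, by rw [← he, Matrix.mulVecLin_apply, Matrix.mulVec_transpose]⟩

variable {A : Type*} [DecidableEq A]

/-- The block of `D` with rows and columns of degree `b`. -/
def degBlock {P Q : Type*} (dP : P → A) (dQ : Q → A) (b : A) (D : Matrix P Q k) :
    Matrix {p // dP p = b} {q // dQ q = b} k :=
  D.submatrix Subtype.val Subtype.val

/-- Extension by zero of a vector indexed by the elements of degree `b`. -/
def extendDeg {Q : Type*} (dQ : Q → A) (b : A) (v : {q // dQ q = b} → k) (q : Q) : k :=
  if h : dQ q = b then v ⟨q, h⟩ else 0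

theorem extendDeg_of_ne {Q : Type*} {dQ : Q → A} {b : A} (v : {q // dQ q = b} → k) {q : Q}
    (h : dQ q ≠ b) : extendDeg dQ b v q = 0 := by
  simp [extendDeg, h]

theorem extendDeg_val {Q : Type*} {dQ : Q → A} {b : A} (v : {q // dQ q = b} → k)
    (q : {q // dQ q = b}) : extendDeg dQ b v q = v q := by
  simp [extendDeg, q.2]

/-- A sum over all indices collapses to the indices of degree `b` if the other terms vanish. -/
theorem sum_degree_eq {Q M : Type*} [Fintype Q] [AddCommMonoid M] (dQ : Q → A) (b : A)
    (f : Q → M) (hf : ∀ q, dQ q ≠ b → f q = 0) :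
    ∑ q : {q // dQ q = b}, f q = ∑ q, f q := by
  rw [← Finset.sum_subset (Finset.subset_univ (Finset.univ.filter (fun q => dQ q = b)))]
  · exact (Finset.sum_subtype _ (by simp) f).symm
  · intro q _ hq
    exact hf q (by simpa using hq)

variable [PartialOrder A] {P Q S : Type*} {dP : P → A} {dQ : Q → A} {dS : S → A}

/-- A matrix all of whose nonzero entries go from a row to a column of larger or equal degree. -/
def IsDegreeIncreasing (dP : P → A) (dQ : Q → A) (D : Matrix P Q k) : Prop :=
  ∀ p q, D p q ≠ 0 → dP p ≤ dQ q

theorem degBlock_mul [Fintype Q] {D : Matrix P Q k} {D' : Matrix Q S k}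
    (hD : IsDegreeIncreasing dP dQ D) (hD' : IsDegreeIncreasing dQ dS D') (b : A) :
    degBlock dP dQ b D * degBlock dQ dS b D' = degBlock dP dS b (D * D') := by
  ext p s
  refine sum_degree_eq dQ b (fun q => D p q * D' q s) fun q hq => ?_
  by_contra hne
  exact hq (le_antisymm (s.2 ▸ hD' q s (right_ne_zero_of_mul hne))
    (p.2 ▸ hD p q (left_ne_zero_of_mul hne)))

theorem vecMul_degBlock [Fintype P] {D : Matrix P Q k} (hD : IsDegreeIncreasing dP dQ D) {b : A}
    (c : P → k) (hc : ∀ p, dP p < b → c p = 0) (q : {q // dQ q = b}) :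
    Matrix.vecMul (fun p : {p // dP p = b} => c p) (degBlock dP dQ b D) q
      = Matrix.vecMul c D q := by
  refine sum_degree_eq dP b (fun p => c p * D p q) fun p hp => ?_
  by_contra hne
  have hle := hD p q (right_ne_zero_of_mul hne)
  rw [q.2] at hle
  exact left_ne_zero_of_mul hne (hc p (lt_of_le_of_ne hle hp))

omit [DecidableEq A] in
/-- A vector supported in an upper set is mapped to a vector supported in it. -/
theorem vecMul_eq_zero_of_notMem [Fintype P] {D : Matrix P Q k} (hD : IsDegreeIncreasing dP dQ D)
    {U : Set A} (hU : IsUpperSet U) {c : P → k} (hc : ∀ p, dP p ∉ U → c p = 0) {q : Q}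
    (hq : dQ q ∉ U) : Matrix.vecMul c D q = 0 := by
  refine Finset.sum_eq_zero fun p _ => ?_
  by_contra hne
  refine hq (hU (hD p q (right_ne_zero_of_mul hne)) ?_)
  by_contra hp
  exact left_ne_zero_of_mul hne (hc p hp)

/-- The dimension of the homology of the degree `b` blocks of `D * D' = 0`. -/
def blockHomologyDim [Fintype Q] [Fintype S] (dP : P → A) (dQ : Q → A) (dS : S → A)
    (D : Matrix P Q k) (D' : Matrix Q S k) (b : A) : ℕ :=
  Fintype.card {q // dQ q = b} - (degBlock dP dQ b D).rank - (degBlock dQ dS b D').rank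

theorem rank_add_rank_le_of_mul_eq_zero [Fintype Q] [Fintype S] (B : Matrix P Q k)
    (B' : Matrix Q S k) (h : B * B' = 0) : B.rank + B'.rank ≤ Fintype.card Q := by
  have hle : LinearMap.range B'.mulVecLin ≤ LinearMap.ker B.mulVecLin := by
    rintro _ ⟨e, rfl⟩
    simp [LinearMap.mem_ker, Matrix.mulVec_mulVec, h]
  have h1 := Submodule.finrank_mono hle
  have h2 := LinearMap.finrank_range_add_finrank_ker B.mulVecLin
  rw [Module.finrank_fintype_fun_eq_card] at h2
  change B'.rank ≤ _ at h1
  change B.rank + _ = _ at h2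
  omega

theorem blockHomologyDim_add [Fintype Q] [Fintype S] {D : Matrix P Q k} {D' : Matrix Q S k}
    (hD : IsDegreeIncreasing dP dQ D) (hD' : IsDegreeIncreasing dQ dS D') (hDD : D * D' = 0)
    (b : A) : blockHomologyDim dP dQ dS D D' b + (degBlock dP dQ b D).rank
      + (degBlock dQ dS b D').rank = Fintype.card {q // dQ q = b} := by
  have h := rank_add_rank_le_of_mul_eq_zero (degBlock dP dQ b D) (degBlock dQ dS b D')
    (by rw [degBlock_mul hD hD', hDD]; rfl)
  unfold blockHomologyDim
  omega

variable [Fintype P] [Fintype Q] [Fintype S] {D : Matrix P Q k} {D' : Matrix Q S k}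

/-- If all blocks in an upper set `U` of degrees are acyclic, then the cochains supported in `U`
are exact. The part of a cocycle in a minimal degree is a cocycle for the block of that degree;
subtracting a coboundary removes it, and one continues with a smaller upper set. -/
theorem exists_vecMul_eq_of_blockHomologyDim_eq_zero (hD : IsDegreeIncreasing dP dQ D)
    (hD' : IsDegreeIncreasing dQ dS D') (hDD : D * D' = 0) (U : Set A) (hU : IsUpperSet U)
    (hb : ∀ b ∈ U, blockHomologyDim dP dQ dS D D' b = 0) (c : Q → k)
    (hc : ∀ q, dQ q ∉ U → c q = 0) (hcoc : Matrix.vecMul c D' = 0) :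
    ∃ e : P → k, (∀ p, dP p ∉ U → e p = 0) ∧ Matrix.vecMul e D = c := by
  classical
  induction hN : (Finset.univ.filter (fun q => dQ q ∈ U)).card using Nat.strong_induction_on
    generalizing U c with
  | _ N ih =>
    by_cases hne : (Finset.univ.filter (fun q => dQ q ∈ U)).Nonempty
    · obtain ⟨q₀, hq₀, hmin⟩ := Finset.exists_minimalFor dQ _ hne
      rw [Finset.mem_filter] at hq₀
      set b := dQ q₀ with hbdef
      have hlt : ∀ q, dQ q < b → c q = 0 := fun q hq => hc q fun hqU =>
        hq.not_ge (hmin (by simpa using hqU) hq.le)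
      obtain ⟨v, hv⟩ := exists_vecMul_eq_of_rank_add_rank (degBlock dP dQ b D)
        (degBlock dQ dS b D') (by rw [degBlock_mul hD hD', hDD]; rfl)
        (by have := blockHomologyDim_add hD hD' hDD b; rw [hb b hq₀.2] at this; omega)
        (fun q => c q) (by
          funext s
          rw [vecMul_degBlock hD' c hlt s, hcoc]
          rfl)
      set e₁ := extendDeg dP b v with he₁
      have he₁U : ∀ p, dP p ∉ U → e₁ p = 0 := fun p hp =>
        extendDeg_of_ne v fun h => hp (h ▸ hq₀.2)
      have hagree : ∀ q, dQ q = b → Matrix.vecMul e₁ D q = c q := by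
        intro q hq
        rw [← vecMul_degBlock hD e₁ (fun p hp => extendDeg_of_ne v hp.ne) ⟨q, hq⟩]
        simp only [he₁, extendDeg_val]
        exact congrFun hv ⟨q, hq⟩
      let U' : Set A := {u | u ∈ U ∧ ¬ u ≤ b}
      have hU' : IsUpperSet U' := fun x y hxy hx =>
        ⟨hU hxy hx.1, fun hy => hx.2 (hxy.trans hy)⟩
      obtain ⟨e₂, he₂U, he₂⟩ := ih (Finset.univ.filter (fun q => dQ q ∈ U')).card
        (by
          rw [← hN]
          refine Finset.card_lt_card ((Finset.ssubset_iff_of_subset fun q hq => ?_).mpr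
            ⟨q₀, by simpa using hq₀.2, fun h => (Finset.mem_filter.mp h).2.2 le_rfl⟩)
          simp only [Finset.mem_filter, Finset.mem_univ, true_and] at hq ⊢
          exact hq.1)
        U' hU' (fun u hu => hb u hu.1) (c - Matrix.vecMul e₁ D)
        (fun q hq => by
          rw [Pi.sub_apply]
          by_cases hqU : dQ q ∈ U
          · have hle : dQ q ≤ b := by
              by_contra hle
              exact hq ⟨hqU, hle⟩
            rw [hagree q (le_antisymm hle (hmin (by simpa using hqU) hle)), sub_self]
          · rw [hc q hqU, vecMul_eq_zero_of_notMem hD hU he₁U hqU, sub_self])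
        (by rw [Matrix.sub_vecMul, hcoc, Matrix.vecMul_vecMul, hDD, Matrix.vecMul_zero, sub_self])
        (by congr)
      refine ⟨e₁ + e₂, fun p hp => ?_, by rw [Matrix.add_vecMul, he₂, add_sub_cancel]⟩
      rw [Pi.add_apply, he₁U p hp, he₂U p fun h => hp h.1, add_zero]
    · have h0 : c = 0 := funext fun q => hc q fun hq => hne ⟨q, by simpa using hq⟩
      exact ⟨0, fun _ _ => rfl, by rw [h0, Matrix.zero_vecMul]⟩

end LinearAlgebra

/-! ### Dimensions of graded pieces of homology -/

section HomologyRank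

variable {k R C V : Type*} [Field k] [CommRing R] [Algebra k R] [AddCommGroup C] [Module R C]
  [Module k C] [IsScalarTower k R C] [AddCommGroup V] [Module k V]

/-- A linear map that carries the cycles in `P` onto `Z'`, and under which the boundaries among
them are exactly the preimage of `B'`, identifies the graded piece of `Z / B` with `Z' / B'`. -/
theorem nonempty_homologyPiece_equiv (Z B : Submodule R C) (P : Submodule k C) (ρ : C →ₗ[k] V)
    (Z' B' : Submodule k V) (hρ : ∀ x ∈ P, x ∈ Z → ρ x ∈ Z')
    (hsurj : ∀ v ∈ Z', ∃ x ∈ P, x ∈ Z ∧ ρ x = v) (hB : ∀ x ∈ P, x ∈ Z → (x ∈ B ↔ ρ x ∈ B')) :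
    Nonempty (homologyPiece Z B P ≃ₗ[k] Z'.map B'.mkQ) := by
  let W : Submodule k Z := P.comap (Z.subtype.restrictScalars k)
  let f : W →ₗ[k] HomologyModule Z B := ((B.submoduleOf Z).mkQ.restrictScalars k) ∘ₗ W.subtype
  let g : W →ₗ[k] V ⧸ B' := B'.mkQ ∘ₗ ρ ∘ₗ (Z.subtype.restrictScalars k) ∘ₗ W.subtype
  have hf : LinearMap.range f = homologyPiece Z B P := by
    rw [LinearMap.range_comp, Submodule.range_subtype]
    rfl
  have hg : LinearMap.range g = Z'.map B'.mkQ := by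
    ext y
    constructor
    · rintro ⟨x, rfl⟩
      exact ⟨ρ x.1.1, hρ _ x.2 x.1.2, rfl⟩
    · rintro ⟨v, hv, rfl⟩
      obtain ⟨x, hP, hZ, rfl⟩ := hsurj v hv
      exact ⟨⟨⟨x, hZ⟩, hP⟩, rfl⟩
  have hker : LinearMap.ker f = LinearMap.ker g := by
    ext x
    have h1 : f x = 0 ↔ x.1.1 ∈ B := Submodule.Quotient.mk_eq_zero (B.submoduleOf Z)
    have h2 : g x = 0 ↔ ρ x.1.1 ∈ B' := Submodule.Quotient.mk_eq_zero B'
    rw [LinearMap.mem_ker, LinearMap.mem_ker, h1, h2]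
    exact hB _ x.2 x.1.2
  exact ⟨(LinearEquiv.ofEq _ _ hf.symm).trans <| f.quotKerEquivRange.symm.trans <|
    (Submodule.quotEquivOfEq _ _ hker).trans <| g.quotKerEquivRange.trans <|
      LinearEquiv.ofEq _ _ hg⟩

theorem finrank_map_mkQ_add [FiniteDimensional k V] (Z' B' : Submodule k V) (hBZ : B' ≤ Z') :
    Module.finrank k (Z'.map B'.mkQ) + Module.finrank k B' = Module.finrank k Z' := by
  have h := LinearMap.finrank_range_add_finrank_ker (B'.mkQ.domRestrict Z')
  rw [LinearMap.range_domRestrict, LinearMap.ker_domRestrict, Submodule.ker_mkQ] at h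
  rwa [(Submodule.comapSubtypeEquivOfLe hBZ).finrank_eq] at h

theorem homologyPiece_eq_bot_iff (Z B : Submodule R C) (P : Submodule k C) :
    homologyPiece Z B P = ⊥ ↔ ∀ x ∈ P, x ∈ Z → x ∈ B := by
  rw [eq_bot_iff]
  constructor
  · intro h x hP hZ
    exact (Submodule.Quotient.mk_eq_zero (B.submoduleOf Z)).mp
      (h ⟨⟨x, hZ⟩, hP, rfl⟩)
  · rintro h _ ⟨x, hx, rfl⟩
    exact (Submodule.Quotient.mk_eq_zero (B.submoduleOf Z)).mpr (h x.1 hx x.2)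

end HomologyRank

/-! ### Coefficients of polynomials at integer exponent vectors -/

section GradedCoeff

variable {k : Type*} [Field k] {n : ℕ}

/-- The exponent vector with entries `max (v j) 0`. -/
def toExponent (v : Fin n → ℤ) : Fin n →₀ ℕ :=
  Finsupp.equivFunOnFinite.symm fun j => (v j).toNat

theorem toExponent_apply (v : Fin n → ℤ) (j : Fin n) : toExponent v j = (v j).toNat := rfl

open Classical in
/-- The coefficient of `x^v` for `v ∈ ℤ^n`, which is zero unless `v ≥ 0`. -/
def gradedCoeff (k : Type*) [Field k] {n : ℕ} (v : Fin n → ℤ) : PolyRing k n →ₗ[k] k :=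
  if 0 ≤ v then MvPolynomial.lcoeff k (toExponent v) else 0

theorem gradedCoeff_of_nonneg {v : Fin n → ℤ} (hv : 0 ≤ v) (f : PolyRing k n) :
    gradedCoeff k v f = MvPolynomial.coeff (toExponent v) f := by
  simp [gradedCoeff, hv]

theorem gradedCoeff_of_not_nonneg {v : Fin n → ℤ} (hv : ¬ 0 ≤ v) (f : PolyRing k n) :
    gradedCoeff k v f = 0 := by
  simp [gradedCoeff, hv]

theorem gradedCoeff_zero (f : PolyRing k n) :
    gradedCoeff k 0 f = MvPolynomial.constantCoeff f := by
  rw [gradedCoeff_of_nonneg le_rfl, MvPolynomial.constantCoeff_eq]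
  congr 1
  ext j
  simp [toExponent_apply]

/-- The monomial `x^v` for `v ∈ ℤ^n`, with the convention that it is zero unless `v ≥ 0`. -/
def gradedMonomial (k : Type*) [Field k] {n : ℕ} (v : Fin n → ℤ) (t : k) : PolyRing k n :=
  open Classical in if 0 ≤ v then MvPolynomial.monomial (toExponent v) t else 0

theorem gradedMonomial_mem (v : Fin n → ℤ) (t : k) : gradedMonomial k v t ∈ polyPiece k v := by
  unfold gradedMonomial
  split_ifs with hv
  · intro m hm j
    rw [Finset.mem_singleton.mp (MvPolynomial.support_monomial_subset hm), toExponent_apply,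
      Int.toNat_of_nonneg (hv j)]
  · exact Submodule.zero_mem _

theorem gradedCoeff_gradedMonomial {v : Fin n → ℤ} (hv : 0 ≤ v) (t : k) :
    gradedCoeff k v (gradedMonomial k v t) = t := by
  simp [gradedCoeff_of_nonneg hv, gradedMonomial, hv]

/-- A homogeneous polynomial of degree `v` is its coefficient times `x^v`. -/
theorem eq_gradedMonomial {v : Fin n → ℤ} {f : PolyRing k n} (hf : f ∈ polyPiece k v) :
    f = gradedMonomial k v (gradedCoeff k v f) := by
  have hm : ∀ m ∈ f.support, 0 ≤ v ∧ m = toExponent v := fun m hm =>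
    ⟨fun j => by rw [← hf m hm j]; exact Int.natCast_nonneg _,
      Finsupp.ext fun j => by rw [toExponent_apply, ← hf m hm j, Int.toNat_natCast]⟩
  by_cases hv : 0 ≤ v
  · rw [gradedCoeff_of_nonneg hv, gradedMonomial, if_pos hv]
    ext m
    rw [MvPolynomial.coeff_monomial]
    split_ifs with h
    · rw [h]
    · by_contra hne
      exact h (hm m (MvPolynomial.mem_support_iff.mpr hne)).2.symm
  · rw [gradedMonomial, if_neg hv]
    ext m
    by_contra hne
    exact hv (hm m (MvPolynomial.mem_support_iff.mpr hne)).1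

theorem eq_zero_of_gradedCoeff_eq_zero {v : Fin n → ℤ} {f : PolyRing k n}
    (hf : f ∈ polyPiece k v) (h : gradedCoeff k v f = 0) : f = 0 := by
  rw [eq_gradedMonomial hf, h]
  simp [gradedMonomial]

theorem gradedCoeff_mul {u v w : Fin n → ℤ} {g : PolyRing k n} (hg : g ∈ polyPiece k u)
    (f : PolyRing k n) (hw : w = u + v) :
    gradedCoeff k w (f * g) = gradedCoeff k v f * gradedCoeff k u g := by
  subst hw
  rw [mul_comm f, mul_comm (gradedCoeff k v f)]
  by_cases hu : 0 ≤ u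
  · conv_lhs => rw [eq_gradedMonomial hg, gradedMonomial, if_pos hu]
    generalize gradedCoeff k u g = t
    by_cases hv : 0 ≤ v
    · have hexp : toExponent (u + v) = toExponent u + toExponent v := by
        ext j
        simp only [toExponent_apply, Finsupp.add_apply, Pi.add_apply]
        have := hu j
        have := hv j
        simp only [Pi.zero_apply] at *
        omega
      rw [gradedCoeff_of_nonneg (add_nonneg hu hv), gradedCoeff_of_nonneg hv, hexp,
        MvPolynomial.coeff_monomial_mul]
    · rw [gradedCoeff_of_not_nonneg hv, mul_zero]
      by_cases huv : 0 ≤ u + v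
      · rw [gradedCoeff_of_nonneg huv, MvPolynomial.coeff_monomial_mul', if_neg]
        intro hle
        refine hv fun j => ?_
        have h1 := hle j
        have h2 := hu j
        have h3 := huv j
        simp only [toExponent_apply, Pi.add_apply, Pi.zero_apply] at *
        omega
      · rw [gradedCoeff_of_not_nonneg huv]
  · have h0 : g = 0 := by
      rw [eq_gradedMonomial hg, gradedMonomial, if_neg hu]
    rw [h0, zero_mul, map_zero, map_zero, zero_mul]

theorem one_mem_polyPiece : (1 : PolyRing k n) ∈ polyPiece k 0 := by
  intro m hm j
  rw [← MvPolynomial.C_1, MvPolynomial.C_apply] at hm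
  rw [Finset.mem_singleton.mp (MvPolynomial.support_monomial_subset hm)]
  simp

theorem mul_mem_polyPiece {u v : Fin n → ℤ} {f g : PolyRing k n} (hf : f ∈ polyPiece k u)
    (hg : g ∈ polyPiece k v) : f * g ∈ polyPiece k (u + v) := by
  classical
  intro m hm j
  obtain ⟨m₁, h₁, m₂, h₂, rfl⟩ := Finset.mem_add.mp (MvPolynomial.support_mul _ _ hm)
  simp [hf m₁ h₁ j, hg m₂ h₂ j]

theorem single_mem_freePiece {b : ℕ} (deg : Fin b → Fin n → ℤ) (q : Fin b) :
    Pi.single q (1 : PolyRing k n) ∈ freePiece k deg (deg q) := by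
  intro p
  by_cases h : p = q
  · subst h
    rw [Pi.single_eq_same, sub_self]
    exact one_mem_polyPiece
  · rw [Pi.single_eq_of_ne h]
    exact Submodule.zero_mem _

theorem constantCoeff_eq_zero_of_mem_polyPiece {u : Fin n → ℤ} (hu : u ≠ 0) {f : PolyRing k n}
    (hf : f ∈ polyPiece k u) : MvPolynomial.constantCoeff f = 0 := by
  by_contra hne
  refine hu (funext fun j => ?_)
  rw [← hf 0 (MvPolynomial.mem_support_iff.mpr hne) j]
  simp

end GradedCoeff

namespace MultigradedFreeResolution

variable {k : Type*} [Field k] {n : ℕ} {I : Ideal (PolyRing k n)} (F : MultigradedFreeResolution I)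

/-! ### Structure constants of a graded resolution -/

/-- The matrix of `F.d i` with its monomials removed: the entry at `(p, q)` is the coefficient of
`x^(deg q - deg p)`, the only monomial that can occur there. -/
def structureMatrix (i : ℕ) : Matrix (Fin (F.rank i)) (Fin (F.rank (i + 1))) k :=
  fun p q => gradedCoeff k (F.deg (i + 1) q - F.deg i p) (F.d i (Pi.single q 1) p)

theorem isDegreeIncreasing_structureMatrix (i : ℕ) :
    IsDegreeIncreasing (F.deg i) (F.deg (i + 1)) (F.structureMatrix i) := by
  intro p q hne
  by_contra hle
  exact hne (gradedCoeff_of_not_nonneg (fun h => hle (sub_nonneg.mp h)) _)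

theorem d_single_mem (i : ℕ) (p : Fin (F.rank i)) (q : Fin (F.rank (i + 1))) :
    F.d i (Pi.single q 1) p ∈ polyPiece k (F.deg (i + 1) q - F.deg i p) :=
  F.d_graded i _ _ (single_mem_freePiece _ q) p

theorem d_comp_d (i : ℕ) (x : F.module (i + 2)) : F.d i (F.d (i + 1) x) = 0 := by
  have h : F.d (i + 1) x ∈ LinearMap.range (F.d (i + 1)) := ⟨x, rfl⟩
  rwa [F.exact_succ i, LinearMap.mem_ker] at h

theorem dual_apply_eq_sum {b : ℕ} {M : Type*} [AddCommMonoid M] [Module (PolyRing k n) M]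
    (φ : (Fin b → PolyRing k n) →ₗ[PolyRing k n] M) (x : Fin b → PolyRing k n) :
    φ x = ∑ q, x q • φ (Pi.single q 1) := by
  conv_lhs => rw [pi_eq_sum_univ' x, map_sum]
  refine Finset.sum_congr rfl fun q _ => ?_
  rw [map_smul]

/-- The coefficients of degree `a` of a cochain `φ`, on all basis vectors. -/
def cochainCoeff (i : ℕ) (a : Fin n → ℤ) : F.extCochains i →ₗ[k] (Fin (F.rank i) → k) where
  toFun φ p := gradedCoeff k (F.deg i p + a) (φ (Pi.single p 1))
  map_add' φ ψ := by
    funext p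
    simp
  map_smul' t φ := by
    funext p
    simp

theorem cochainCoeff_apply (i : ℕ) (a : Fin n → ℤ) (φ : F.extCochains i) (p : Fin (F.rank i)) :
    F.cochainCoeff i a φ p = gradedCoeff k (F.deg i p + a) (φ (Pi.single p 1)) := rfl

theorem cochainCoeff_eq_zero {i : ℕ} {a : Fin n → ℤ} (φ : F.extCochains i) {p : Fin (F.rank i)}
    (hp : ¬ -a ≤ F.deg i p) : F.cochainCoeff i a φ p = 0 :=
  gradedCoeff_of_not_nonneg (fun h => hp (neg_le_iff_add_nonneg.mpr h)) _

theorem cochainCoeff_extDifferential (i : ℕ) (a : Fin n → ℤ) (φ : F.extCochains i) :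
    F.cochainCoeff (i + 1) a (F.extDifferential i φ)
      = Matrix.vecMul (F.cochainCoeff i a φ) (F.structureMatrix i) := by
  funext q
  rw [cochainCoeff_apply, extDifferential, LinearMap.dualMap_apply, dual_apply_eq_sum φ, map_sum]
  refine Finset.sum_congr rfl fun p _ => ?_
  rw [smul_eq_mul, mul_comm]
  exact gradedCoeff_mul (F.d_single_mem i p q) _ (by abel)

theorem extDifferential_comp (i : ℕ) (φ : F.extCochains i) :
    F.extDifferential (i + 1) (F.extDifferential i φ) = 0 := by
  refine LinearMap.ext fun x => ?_
  change φ (F.d i (F.d (i + 1) x)) = 0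
  rw [d_comp_d, map_zero]

theorem structureMatrix_mul (i : ℕ) : F.structureMatrix i * F.structureMatrix (i + 1) = 0 := by
  ext p r
  -- The `p`-th row is the coefficient vector of the coordinate function `p`.
  have hp : F.cochainCoeff i (-F.deg i p) (LinearMap.proj p) = Pi.single p 1 := by
    funext q
    rw [cochainCoeff_apply, LinearMap.proj_apply]
    by_cases h : q = p
    · subst h
      rw [Pi.single_eq_same, Pi.single_eq_same, add_neg_cancel, gradedCoeff_zero, map_one]
    · rw [Pi.single_eq_of_ne h, Pi.single_eq_of_ne' h, map_zero]
  have h := congrArg (fun φ => F.cochainCoeff (i + 2) (-F.deg i p) φ r)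
    (F.extDifferential_comp i (LinearMap.proj p))
  simp only [cochainCoeff_extDifferential, hp, Matrix.single_one_vecMul,
    map_zero] at h
  exact h

theorem mem_dualPiece_iff (i : ℕ) (a : Fin n → ℤ) (φ : F.extCochains i) :
    φ ∈ dualPiece k (F.deg i) a ↔ ∀ p, φ (Pi.single p 1) ∈ polyPiece k (F.deg i p + a) := by
  constructor
  · intro h p
    exact h _ _ (single_mem_freePiece _ p)
  · intro h c x hx
    rw [dual_apply_eq_sum φ]
    refine Submodule.sum_mem _ fun p _ => ?_
    have := mul_mem_polyPiece (hx p) (h p)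
    rwa [show c - F.deg i p + (F.deg i p + a) = c + a by abel] at this

theorem extDifferential_mem_dualPiece {i : ℕ} {a : Fin n → ℤ} {φ : F.extCochains i}
    (hφ : φ ∈ dualPiece k (F.deg i) a) : F.extDifferential i φ ∈ dualPiece k (F.deg (i + 1)) a :=
  fun c x hx => hφ c _ (F.d_graded i c x hx)

theorem eq_of_cochainCoeff_eq {i : ℕ} {a : Fin n → ℤ} {φ ψ : F.extCochains i}
    (hφ : φ ∈ dualPiece k (F.deg i) a) (hψ : ψ ∈ dualPiece k (F.deg i) a)
    (h : F.cochainCoeff i a φ = F.cochainCoeff i a ψ) : φ = ψ := by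
  rw [← sub_eq_zero]
  have hmem := (F.mem_dualPiece_iff i a _).mp (Submodule.sub_mem _ hφ hψ)
  refine LinearMap.ext fun x => ?_
  rw [dual_apply_eq_sum (φ - ψ)]
  refine Finset.sum_eq_zero fun p _ => ?_
  have h0 : F.cochainCoeff i a (φ - ψ) p = 0 := by rw [map_sub, h, sub_self]; rfl
  rw [eq_zero_of_gradedCoeff_eq_zero (hmem p) h0, smul_zero]

/-- Every coefficient vector supported in degrees `≥ -a` comes from a cochain of degree `a`. -/
theorem exists_cochainCoeff_eq (i : ℕ) (a : Fin n → ℤ) (c : Fin (F.rank i) → k)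
    (hc : ∀ p, ¬ -a ≤ F.deg i p → c p = 0) :
    ∃ φ ∈ dualPiece k (F.deg i) a, F.cochainCoeff i a φ = c := by
  let φ : F.extCochains i :=
    Fintype.linearCombination (PolyRing k n) fun p => gradedMonomial k (F.deg i p + a) (c p)
  have hφ : ∀ p, φ (Pi.single p 1) = gradedMonomial k (F.deg i p + a) (c p) := fun p => by
    simp only [φ, Fintype.linearCombination_apply_single, one_smul]
  refine ⟨φ, (F.mem_dualPiece_iff i a φ).mpr fun p => ?_, funext fun p => ?_⟩
  · rw [hφ]
    exact gradedMonomial_mem _ _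
  · rw [cochainCoeff_apply, hφ]
    by_cases h : -a ≤ F.deg i p
    · exact gradedCoeff_gradedMonomial (neg_le_iff_add_nonneg.mp h) _
    · rw [hc p h]
      exact gradedCoeff_of_not_nonneg (fun h' => h (neg_le_iff_add_nonneg.mpr h')) _

theorem mem_extCocycles_iff {i : ℕ} {a : Fin n → ℤ} {φ : F.extCochains i}
    (hφ : φ ∈ dualPiece k (F.deg i) a) : φ ∈ F.extCocycles i ↔
      Matrix.vecMul (F.cochainCoeff i a φ) (F.structureMatrix i) = 0 := by
  rw [extCocycles, LinearMap.mem_ker, ← cochainCoeff_extDifferential]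
  refine ⟨fun h => by rw [h, map_zero], fun h => ?_⟩
  exact F.eq_of_cochainCoeff_eq (F.extDifferential_mem_dualPiece hφ) (Submodule.zero_mem _)
    (by rw [h, map_zero])

theorem mem_extCoboundaries_succ_iff {i : ℕ} {a : Fin n → ℤ} {φ : F.extCochains (i + 1)}
    (hφ : φ ∈ dualPiece k (F.deg (i + 1)) a) : φ ∈ F.extCoboundaries (i + 1) ↔
      ∃ e : Fin (F.rank i) → k, (∀ p, ¬ -a ≤ F.deg i p → e p = 0) ∧
        Matrix.vecMul e (F.structureMatrix i) = F.cochainCoeff (i + 1) a φ := by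
  constructor
  · rintro ⟨ψ, rfl⟩
    exact ⟨F.cochainCoeff i a ψ, fun p hp => F.cochainCoeff_eq_zero ψ hp,
      (F.cochainCoeff_extDifferential i a ψ).symm⟩
  · rintro ⟨e, he, hφe⟩
    obtain ⟨ψ, hψ, rfl⟩ := F.exists_cochainCoeff_eq i a e he
    refine ⟨ψ, F.eq_of_cochainCoeff_eq (F.extDifferential_mem_dualPiece hψ) hφ ?_⟩
    rw [cochainCoeff_extDifferential, hφe]

end MultigradedFreeResolution

namespace MultigradedFreeResolution

variable {k : Type*} [Field k] {n : ℕ} {I : Ideal (PolyRing k n)} (F : MultigradedFreeResolution I)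

/-! ### The complex `F ⊗ k` -/

theorem mem_irrelevantIdeal_iff (f : PolyRing k n) :
    f ∈ irrelevantIdeal k n ↔ MvPolynomial.constantCoeff f = 0 := by
  rw [irrelevantIdeal, ← Set.image_univ, MvPolynomial.mem_ideal_span_X_image]
  constructor
  · intro h
    by_contra hne
    obtain ⟨j, _, hj⟩ := h 0 (MvPolynomial.mem_support_iff.mpr hne)
    exact hj rfl
  · intro h m hm
    by_contra hne
    push Not at hne
    refine MvPolynomial.mem_support_iff.mp hm ?_
    rw [show m = 0 from Finsupp.ext fun j => hne j (Set.mem_univ j)]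
    exact h

/-- The constant coefficient, as a map on the residue field `R / (x_1, …, x_n)`. -/
def residueCoeff (k : Type*) [Field k] (n : ℕ) : (PolyRing k n ⧸ irrelevantIdeal k n) →ₗ[k] k :=
  (Ideal.Quotient.liftₐ (irrelevantIdeal k n) (MvPolynomial.aeval (0 : Fin n → k)) (by
    intro f hf
    rw [mem_irrelevantIdeal_iff] at hf
    rw [MvPolynomial.aeval_zero, hf, map_zero])).toLinearMap

theorem residueCoeff_mk (f : PolyRing k n) :
    residueCoeff k n (Ideal.Quotient.mk _ f) = MvPolynomial.constantCoeff f := by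
  simp [residueCoeff]

theorem smul_one_residue (r : PolyRing k n) :
    r • (1 : PolyRing k n ⧸ irrelevantIdeal k n) = Ideal.Quotient.mk _ r := by
  rw [← Ideal.Quotient.algebraMap_eq, Algebra.algebraMap_eq_smul_one]

/-- The coordinates of a chain of `F ⊗ k`. -/
def torCoord (i : ℕ) : F.torChains i →ₗ[k] (Fin (F.rank i) → k) :=
  LinearMap.pi fun p => residueCoeff k n ∘ₗ LinearMap.proj p ∘ₗ
    ((TensorProduct.comm _ _ _).trans (TensorProduct.piScalarRight (PolyRing k n) (PolyRing k n)
      (PolyRing k n ⧸ irrelevantIdeal k n) (Fin (F.rank i)))).toLinearMap.restrictScalars k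

theorem torCoord_tmul (i : ℕ) (x : F.module i) (p : Fin (F.rank i)) :
    F.torCoord i (x ⊗ₜ[PolyRing k n] 1) p = MvPolynomial.constantCoeff (x p) := by
  rw [← residueCoeff_mk]
  simp [torCoord, smul_one_residue]

theorem exists_tmul_one (i : ℕ) (z : F.torChains i) :
    ∃ x : F.module i, z = x ⊗ₜ[PolyRing k n] 1 := by
  induction z using TensorProduct.induction_on with
  | zero => exact ⟨0, (TensorProduct.zero_tmul _ _).symm⟩
  | tmul x r =>
    obtain ⟨r, rfl⟩ := Ideal.Quotient.mk_surjective r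
    refine ⟨r • x, ?_⟩
    rw [TensorProduct.smul_tmul, smul_one_residue]
  | add x y hx hy =>
    obtain ⟨x, rfl⟩ := hx
    obtain ⟨y, rfl⟩ := hy
    exact ⟨x + y, (TensorProduct.add_tmul _ _ _).symm⟩

theorem torCoord_injective (i : ℕ) : Function.Injective (F.torCoord i) := by
  rw [injective_iff_map_eq_zero]
  intro z hz
  obtain ⟨x, rfl⟩ := F.exists_tmul_one i z
  have hx : ∀ p, x p ∈ irrelevantIdeal k n := fun p => by
    rw [mem_irrelevantIdeal_iff, ← torCoord_tmul, hz]
    rfl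
  rw [pi_eq_sum_univ' x, TensorProduct.sum_tmul]
  refine Finset.sum_eq_zero fun p _ => ?_
  rw [TensorProduct.smul_tmul, smul_one_residue,
    Ideal.Quotient.eq_zero_iff_mem.mpr (hx p), TensorProduct.tmul_zero]

theorem torCoord_torDifferential (i : ℕ) (x : F.module (i + 1)) (p : Fin (F.rank i)) :
    F.torCoord i (F.torDifferential i (x ⊗ₜ 1)) p
      = ∑ q, MvPolynomial.constantCoeff (F.d i (Pi.single q 1) p)
          * MvPolynomial.constantCoeff (x q) := by
  rw [torDifferential, LinearMap.rTensor_tmul, torCoord_tmul, dual_apply_eq_sum (F.d i),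
    Finset.sum_apply, map_sum]
  refine Finset.sum_congr rfl fun q _ => ?_
  rw [Pi.smul_apply, smul_eq_mul, map_mul, mul_comm]

theorem constantCoeff_d_single_of_ne {i : ℕ} {p : Fin (F.rank i)} {q : Fin (F.rank (i + 1))}
    (h : F.deg i p ≠ F.deg (i + 1) q) :
    MvPolynomial.constantCoeff (F.d i (Pi.single q 1) p) = 0 :=
  constantCoeff_eq_zero_of_mem_polyPiece (sub_ne_zero.mpr h.symm) (F.d_single_mem i p q)

theorem constantCoeff_d_single_of_eq {i : ℕ} {p : Fin (F.rank i)} {q : Fin (F.rank (i + 1))}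
    (h : F.deg i p = F.deg (i + 1) q) :
    MvPolynomial.constantCoeff (F.d i (Pi.single q 1) p) = F.structureMatrix i p q := by
  rw [structureMatrix, h, sub_self, gradedCoeff_zero]

/-- The block of degree `b` of the structure matrix is the degree `b` part of `F ⊗ k`. -/
theorem torCoord_torDifferential_block (i : ℕ) (z : F.torChains (i + 1)) (b : Fin n → ℤ)
    (p : {p // F.deg i p = b}) : F.torCoord i (F.torDifferential i z) p =
      Matrix.mulVec (degBlock (F.deg i) (F.deg (i + 1)) b (F.structureMatrix i))
        (fun q => F.torCoord (i + 1) z q) p := by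
  obtain ⟨x, rfl⟩ := F.exists_tmul_one _ z
  rw [torCoord_torDifferential]
  simp only [torCoord_tmul]
  rw [← sum_degree_eq (F.deg (i + 1)) b]
  · refine Finset.sum_congr rfl fun q _ => ?_
    rw [F.constantCoeff_d_single_of_eq (p.2.trans q.2.symm)]
    rfl
  · intro q hq
    rw [F.constantCoeff_d_single_of_ne (by rw [p.2]; exact hq.symm), zero_mul]

/-- A chain is in the piece of degree `b` iff its coordinates vanish in all other degrees. -/
theorem mem_torChainPiece_iff (i : ℕ) (b : Fin n → ℤ) (z : F.torChains i) :
    z ∈ F.torChainPiece i b ↔ ∀ p, F.deg i p ≠ b → F.torCoord i z p = 0 := by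
  constructor
  · rintro ⟨x, hx, rfl⟩ p hp
    change F.torCoord i (x ⊗ₜ 1) p = 0
    rw [torCoord_tmul]
    exact constantCoeff_eq_zero_of_mem_polyPiece (sub_ne_zero.mpr hp.symm) (hx p)
  · intro h
    refine ⟨fun p => MvPolynomial.C (F.torCoord i z p), fun p => ?_, F.torCoord_injective i ?_⟩
    · change MvPolynomial.C (F.torCoord i z p) ∈ _
      by_cases hp : F.deg i p = b
      · rw [hp, sub_self, ← mul_one (MvPolynomial.C _), ← MvPolynomial.smul_eq_C_mul]
        exact Submodule.smul_mem _ _ one_mem_polyPiece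
      · rw [h p hp, map_zero]
        exact Submodule.zero_mem _
    · funext p
      change F.torCoord i (_ ⊗ₜ 1) p = _
      rw [torCoord_tmul, MvPolynomial.constantCoeff_C]

/-- Chains of degree `b` are arbitrary vectors indexed by the basis elements of degree `b`. -/
theorem exists_mem_torChainPiece (i : ℕ) (b : Fin n → ℤ) (v : {p // F.deg i p = b} → k) :
    ∃ z ∈ F.torChainPiece i b, F.torCoord i z = extendDeg (F.deg i) b v := by
  have hz : F.torCoord i ((fun p => MvPolynomial.C (extendDeg (F.deg i) b v p)) ⊗ₜ 1)
      = extendDeg (F.deg i) b v := by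
    funext p
    rw [torCoord_tmul, MvPolynomial.constantCoeff_C]
  refine ⟨_, (F.mem_torChainPiece_iff i b _).mpr fun p hp => ?_, hz⟩
  rw [hz, extendDeg_of_ne v hp]

theorem torDifferential_mem_torChainPiece {i : ℕ} {b : Fin n → ℤ} {z : F.torChains (i + 1)}
    (hz : z ∈ F.torChainPiece (i + 1) b) : F.torDifferential i z ∈ F.torChainPiece i b := by
  obtain ⟨x, hx, rfl⟩ := hz
  exact ⟨F.d i x, F.d_graded i b x hx, rfl⟩

theorem eq_of_mem_torChainPiece {i : ℕ} {b : Fin n → ℤ} {y z : F.torChains i}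
    (hy : y ∈ F.torChainPiece i b) (hz : z ∈ F.torChainPiece i b)
    (h : ∀ p : {p // F.deg i p = b}, F.torCoord i y p = F.torCoord i z p) : y = z := by
  refine F.torCoord_injective i (funext fun p => ?_)
  by_cases hp : F.deg i p = b
  · exact h ⟨p, hp⟩
  · rw [(F.mem_torChainPiece_iff i b y).mp hy p hp, (F.mem_torChainPiece_iff i b z).mp hz p hp]

/-- The dimension of `Tor_{i+1}(R / I, k)_b`, in terms of ranks. -/
def torDim (i : ℕ) (b : Fin n → ℤ) : ℕ :=
  blockHomologyDim (F.deg i) (F.deg (i + 1)) (F.deg (i + 2)) (F.structureMatrix i)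
    (F.structureMatrix (i + 1)) b

theorem torDim_add (i : ℕ) (b : Fin n → ℤ) : F.torDim i b +
    (degBlock (F.deg i) (F.deg (i + 1)) b (F.structureMatrix i)).rank +
    (degBlock (F.deg (i + 1)) (F.deg (i + 2)) b (F.structureMatrix (i + 1))).rank
      = Fintype.card {q // F.deg (i + 1) q = b} :=
  blockHomologyDim_add (F.isDegreeIncreasing_structureMatrix i)
    (F.isDegreeIncreasing_structureMatrix (i + 1)) (F.structureMatrix_mul i) b

theorem rank_torPiece (i : ℕ) (b : Fin n → ℤ) :
    Module.rank k (F.torPiece (i + 1) b) = F.torDim i b := by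
  set D := degBlock (F.deg i) (F.deg (i + 1)) b (F.structureMatrix i) with hD
  set D' := degBlock (F.deg (i + 1)) (F.deg (i + 2)) b (F.structureMatrix (i + 1)) with hD'
  have hDD : D * D' = 0 := by
    rw [hD, hD', degBlock_mul (F.isDegreeIncreasing_structureMatrix i)
      (F.isDegreeIncreasing_structureMatrix (i + 1)), structureMatrix_mul]
    rfl
  have hle : LinearMap.range D'.mulVecLin ≤ LinearMap.ker D.mulVecLin := by
    rintro _ ⟨e, rfl⟩
    simp [LinearMap.mem_ker, Matrix.mulVec_mulVec, hDD]
  let ρ : F.torChains (i + 1) →ₗ[k] ({q // F.deg (i + 1) q = b} → k) :=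
    LinearMap.funLeft k k Subtype.val ∘ₗ F.torCoord (i + 1)
  have hcyc : ∀ z ∈ F.torChainPiece (i + 1) b,
      z ∈ F.torCycles (i + 1) ↔ ρ z ∈ LinearMap.ker D.mulVecLin := by
    intro z hz
    rw [LinearMap.mem_ker]
    change F.torDifferential i z = 0 ↔ _
    constructor
    · intro h
      funext p
      have := F.torCoord_torDifferential_block i z b p
      rw [h, map_zero] at this
      exact this.symm
    · intro h
      refine F.eq_of_mem_torChainPiece (F.torDifferential_mem_torChainPiece hz)
        (Submodule.zero_mem _) fun p => ?_
      rw [F.torCoord_torDifferential_block i z b p, map_zero]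
      exact congrFun h p
  obtain ⟨e⟩ := nonempty_homologyPiece_equiv (F.torCycles (i + 1)) (F.torBoundaries (i + 1))
    (F.torChainPiece (i + 1) b) ρ (LinearMap.ker D.mulVecLin) (LinearMap.range D'.mulVecLin)
    (fun z hz h => (hcyc z hz).mp h)
    (fun v hv => by
      obtain ⟨z, hz, hzv⟩ := F.exists_mem_torChainPiece (i + 1) b v
      have hρ : ρ z = v := funext fun q => by
        change F.torCoord (i + 1) z q = v q
        rw [hzv, extendDeg_val]
      exact ⟨z, hz, (hcyc z hz).mpr (hρ ▸ hv), hρ⟩)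
    (fun z hz _ => by
      constructor
      · rintro ⟨w, rfl⟩
        exact ⟨fun s => F.torCoord (i + 2) w s,
          funext fun q => (F.torCoord_torDifferential_block (i + 1) w b q).symm⟩
      · rintro ⟨u, hu⟩
        obtain ⟨w, hw, hwu⟩ := F.exists_mem_torChainPiece (i + 2) b u
        refine ⟨w, F.eq_of_mem_torChainPiece (F.torDifferential_mem_torChainPiece hw) hz
          fun q => ?_⟩
        rw [F.torCoord_torDifferential_block (i + 1) w b q, hwu]
        simp only [extendDeg_val]
        exact congrFun hu q)
  have h1 := finrank_map_mkQ_add _ _ hle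
  have h2 := LinearMap.finrank_range_add_finrank_ker D.mulVecLin
  have h3 := F.torDim_add i b
  rw [← hD, ← hD'] at h3
  rw [Module.finrank_fintype_fun_eq_card] at h2
  change _ + D'.rank = _ at h1
  change D.rank + _ = _ at h2
  rw [torPiece, e.rank_eq, ← Module.finrank_eq_rank]
  norm_cast
  omega

theorem torPiece_eq_bot_iff (i : ℕ) (b : Fin n → ℤ) :
    F.torPiece (i + 1) b = ⊥ ↔ F.torDim i b = 0 := by
  rw [← Submodule.rank_eq_zero, rank_torPiece, Nat.cast_eq_zero]

end MultigradedFreeResolution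

namespace MultigradedFreeResolution

variable {k : Type*} [Field k] {n : ℕ} {I : Ideal (PolyRing k n)} (F : MultigradedFreeResolution I)

/-! ### Graded pieces of `Ext` in terms of graded pieces of `Tor` -/

/-- `Ext^{i+1}(R / I, R)_{-a}` vanishes if `Tor_{i+1}(R / I, k)` vanishes in all degrees `≥ a`. -/
theorem extPiece_eq_bot (i : ℕ) (a : Fin n → ℤ) (h : ∀ b, a ≤ b → F.torDim i b = 0) :
    F.extPiece (i + 1) (-a) = ⊥ := by
  rw [extPiece, homologyPiece_eq_bot_iff]
  intro φ hφ hcoc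
  rw [F.mem_extCoboundaries_succ_iff hφ]
  refine exists_vecMul_eq_of_blockHomologyDim_eq_zero (F.isDegreeIncreasing_structureMatrix i)
    (F.isDegreeIncreasing_structureMatrix (i + 1)) (F.structureMatrix_mul i)
    {b | - -a ≤ b} (fun x y hxy hx => le_trans hx hxy) (fun b hb => h b ?_) _
    (fun q hq => F.cochainCoeff_eq_zero φ hq) ((F.mem_extCocycles_iff hφ).mp hcoc)
  rwa [Set.mem_ofPred_eq, neg_neg] at hb

/-- If `Tor_{i+1}` and `Tor_{i+2}` vanish in all degrees `> a`, then `Ext^{i+1}(R / I, R)_{-a}` has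
the same dimension as `Tor_{i+1}(R / I, k)_a`. The cochains of degree `-a` are supported in degrees
`≥ a`; those supported in degrees `> a` form a complex that is exact in cohomological degrees
`i + 1` and `i + 2`, and the quotient by it is the dual of the degree `a` part of `F ⊗ k`. -/
theorem rank_extPiece (i : ℕ) (a : Fin n → ℤ) (h₁ : ∀ b, a < b → F.torDim i b = 0)
    (h₂ : ∀ b, a < b → F.torDim (i + 1) b = 0) :
    Module.rank k (F.extPiece (i + 1) (-a)) = F.torDim i a := by
  set D := degBlock (F.deg i) (F.deg (i + 1)) a (F.structureMatrix i) with hD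
  set D' := degBlock (F.deg (i + 1)) (F.deg (i + 2)) a (F.structureMatrix (i + 1)) with hD'
  have inc := F.isDegreeIncreasing_structureMatrix
  have hDD : D * D' = 0 := by
    rw [hD, hD', degBlock_mul (inc i) (inc (i + 1)), structureMatrix_mul]
    rfl
  have hUU : IsUpperSet (Set.Ioi a) := fun x y hxy hx => lt_of_lt_of_le hx hxy
  have hle : LinearMap.range D.transpose.mulVecLin ≤ LinearMap.ker D'.transpose.mulVecLin := by
    rintro _ ⟨e, rfl⟩
    simp [LinearMap.mem_ker, Matrix.vecMul_vecMul, hDD]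
  let ρ : F.extCochains (i + 1) →ₗ[k] ({q // F.deg (i + 1) q = a} → k) :=
    LinearMap.funLeft k k Subtype.val ∘ₗ F.cochainCoeff (i + 1) (-a)
  have hsupp : ∀ φ : F.extCochains (i + 1), ∀ q, ¬ a ≤ F.deg (i + 1) q →
      F.cochainCoeff (i + 1) (-a) φ q = 0 := fun φ q hq =>
    F.cochainCoeff_eq_zero φ (by rwa [neg_neg])
  obtain ⟨e⟩ := nonempty_homologyPiece_equiv (F.extCocycles (i + 1)) (F.extCoboundaries (i + 1))
    (dualPiece k (F.deg (i + 1)) (-a)) ρ (LinearMap.ker D'.transpose.mulVecLin)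
    (LinearMap.range D.transpose.mulVecLin)
    (fun φ hφ hcoc => by
      rw [LinearMap.mem_ker, Matrix.mulVecLin_apply, Matrix.mulVec_transpose]
      funext s
      refine (vecMul_degBlock (inc (i + 1)) (F.cochainCoeff (i + 1) (-a) φ)
        (fun q hq => hsupp φ q hq.not_ge) s).trans ?_
      rw [(F.mem_extCocycles_iff hφ).mp hcoc]
      rfl)
    (fun v hv => by
      -- The coboundary of `v`, extended by zero, is a cocycle in degrees `> a`, hence the coboundary
      -- of some `e` in degrees `> a`; subtracting `e` extends `v` to a cocycle.
      rw [LinearMap.mem_ker, Matrix.mulVecLin_apply, Matrix.mulVec_transpose] at hv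
      set c := extendDeg (F.deg (i + 1)) a v with hc
      have hca : ∀ q, F.deg (i + 1) q ∉ Set.Ici a → c q = 0 := fun q hq =>
        extendDeg_of_ne v fun h => hq h.ge
      obtain ⟨e, he, hec⟩ := exists_vecMul_eq_of_blockHomologyDim_eq_zero (inc (i + 1))
        (inc (i + 2)) (F.structureMatrix_mul (i + 1)) (Set.Ioi a) hUU h₂
        (Matrix.vecMul c (F.structureMatrix (i + 1)))
        (fun s hs => by
          by_cases hsa : F.deg (i + 2) s = a
          · rw [← vecMul_degBlock (inc (i + 1)) c (fun q hq => hca q hq.not_ge) ⟨s, hsa⟩]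
            simp only [hc, extendDeg_val]
            exact congrFun hv ⟨s, hsa⟩
          · exact vecMul_eq_zero_of_notMem (inc (i + 1)) (isUpperSet_Ici a) hca
              fun h => hs (lt_of_le_of_ne h (Ne.symm hsa)))
        (by rw [Matrix.vecMul_vecMul, structureMatrix_mul, Matrix.vecMul_zero])
      obtain ⟨φ, hφ, hφc⟩ := F.exists_cochainCoeff_eq (i + 1) (-a) (c - e) (fun q hq => by
        rw [neg_neg] at hq
        rw [Pi.sub_apply, hca q hq, he q fun h => hq h.le, sub_zero])
      refine ⟨φ, hφ, (F.mem_extCocycles_iff hφ).mpr ?_, funext fun q => ?_⟩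
      · rw [hφc, Matrix.sub_vecMul, hec, sub_self]
      · change F.cochainCoeff (i + 1) (-a) φ q = v q
        rw [hφc, Pi.sub_apply, hc, extendDeg_val, he q (by simp [q.2]), sub_zero])
    (fun φ hφ hcoc => by
      rw [F.mem_extCoboundaries_succ_iff hφ, LinearMap.mem_range]
      simp only [Matrix.mulVecLin_apply, Matrix.mulVec_transpose, neg_neg]
      constructor
      · rintro ⟨e, he, heφ⟩
        refine ⟨fun p => e p, funext fun q => ?_⟩
        refine (vecMul_degBlock (inc i) e (fun p hp => he p hp.not_ge) q).trans ?_
        rw [heφ]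
        rfl
      · rintro ⟨u, hu⟩
        set e₁ := extendDeg (F.deg i) a u with he₁
        have he₁a : ∀ p, F.deg i p ∉ Set.Ici a → e₁ p = 0 := fun p hp =>
          extendDeg_of_ne u fun h => hp h.ge
        obtain ⟨e₂, he₂, he₂c⟩ := exists_vecMul_eq_of_blockHomologyDim_eq_zero (inc i)
          (inc (i + 1)) (F.structureMatrix_mul i) (Set.Ioi a) hUU h₁
          (F.cochainCoeff (i + 1) (-a) φ - Matrix.vecMul e₁ (F.structureMatrix i))
          (fun q hq => by
            rw [Pi.sub_apply]
            by_cases hqa : F.deg (i + 1) q = a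
            · rw [← vecMul_degBlock (inc i) e₁ (fun p hp => he₁a p hp.not_ge) ⟨q, hqa⟩]
              simp only [he₁, extendDeg_val]
              rw [sub_eq_zero]
              exact (congrFun hu ⟨q, hqa⟩).symm
            · have hle : ¬ a ≤ F.deg (i + 1) q :=
                fun h => hq (lt_of_le_of_ne h (Ne.symm hqa))
              rw [hsupp φ q hle, vecMul_eq_zero_of_notMem (inc i) (isUpperSet_Ici a) he₁a hle,
                sub_zero])
          (by rw [Matrix.sub_vecMul, (F.mem_extCocycles_iff hφ).mp hcoc, Matrix.vecMul_vecMul,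
            structureMatrix_mul, Matrix.vecMul_zero, sub_zero])
        refine ⟨e₁ + e₂, fun p hp => ?_, by rw [Matrix.add_vecMul, he₂c, add_sub_cancel]⟩
        rw [Pi.add_apply, he₁a p hp, he₂ p fun h => hp h.le, add_zero])
  have h1 := finrank_map_mkQ_add _ _ hle
  have h2 := LinearMap.finrank_range_add_finrank_ker D'.transpose.mulVecLin
  have h3 := F.torDim_add i a
  rw [← hD, ← hD', ← Matrix.rank_transpose D, ← Matrix.rank_transpose D'] at h3
  rw [Module.finrank_fintype_fun_eq_card] at h2
  change _ + D.transpose.rank = _ at h1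
  change D'.transpose.rank + _ = _ at h2
  rw [extPiece, e.rank_eq, ← Module.finrank_eq_rank]
  norm_cast
  omega

end MultigradedFreeResolution

/-! ### Vanishing of `Tor` beyond the number of variables -/

section InitialVariables

variable {k : Type*} [Field k] {n : ℕ}

/-- The ideal generated by the first `t` variables. -/
def initialVariablesIdeal (k : Type*) [Field k] (n t : ℕ) : Ideal (PolyRing k n) :=
  Ideal.span (MvPolynomial.X '' {s : Fin n | s.val < t})

theorem initialVariablesIdeal_zero : initialVariablesIdeal k n 0 = ⊥ := by
  simp [initialVariablesIdeal]

theorem initialVariablesIdeal_self : initialVariablesIdeal k n n = irrelevantIdeal k n := by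
  simp [initialVariablesIdeal, irrelevantIdeal]

theorem mem_initialVariablesIdeal_succ {t : ℕ} (ht : t < n) (f : PolyRing k n) :
    f ∈ initialVariablesIdeal k n (t + 1) ↔
      ∃ w, ∃ g ∈ initialVariablesIdeal k n t, f = w * MvPolynomial.X ⟨t, ht⟩ + g := by
  have hset : {s : Fin n | s.val < t + 1} = insert ⟨t, ht⟩ {s : Fin n | s.val < t} := by
    ext s
    simp only [Set.mem_ofPred_eq, Set.mem_insert_iff, Fin.ext_iff]
    omega
  rw [initialVariablesIdeal, hset, Set.image_insert_eq, Ideal.mem_span_insert]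
  rfl

/-- The next variable is a nonzerodivisor modulo the preceding ones. -/
theorem mem_initialVariablesIdeal_of_mul_X {t : ℕ} (ht : t < n) {f : PolyRing k n}
    (hf : f * MvPolynomial.X ⟨t, ht⟩ ∈ initialVariablesIdeal k n t) :
    f ∈ initialVariablesIdeal k n t := by
  rw [initialVariablesIdeal, MvPolynomial.mem_ideal_span_X_image] at hf ⊢
  intro m hm
  obtain ⟨s, hs, hms⟩ := hf (m + Finsupp.single ⟨t, ht⟩ 1) (by
    rwa [MvPolynomial.mem_support_iff, MvPolynomial.coeff_mul_X, ← MvPolynomial.mem_support_iff])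
  refine ⟨s, hs, ?_⟩
  have hne : (⟨t, ht⟩ : Fin n) ≠ s := fun h => by
    subst h
    exact lt_irrefl t hs
  rwa [Finsupp.add_apply, Finsupp.single_eq_of_ne' hne, add_zero] at hms

end InitialVariables

namespace MultigradedFreeResolution

variable {k : Type*} [Field k] {n : ℕ} {I : Ideal (PolyRing k n)} (F : MultigradedFreeResolution I)

theorem d_apply_mem {i : ℕ} {J : Ideal (PolyRing k n)} {x : F.module (i + 1)} (hx : ∀ q, x q ∈ J)
    (p : Fin (F.rank i)) : F.d i x p ∈ J := by
  rw [dual_apply_eq_sum (F.d i), Finset.sum_apply]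
  exact Ideal.sum_mem _ fun q _ => Ideal.mul_mem_right _ _ (hx q)

/-- Modulo the first `t` variables, `F` is exact beyond position `t`: adding a variable, which is a
nonzerodivisor modulo the preceding ones, raises the range of possible homology by one. -/
theorem exists_sub_d_mem_initialVariablesIdeal (t : ℕ) (ht : t ≤ n) :
    ∀ (i : ℕ), t ≤ i → ∀ z : F.module (i + 1),
      (∀ p, F.d i z p ∈ initialVariablesIdeal k n t) →
      ∃ u, ∀ q, (z - F.d (i + 1) u) q ∈ initialVariablesIdeal k n t := by
  induction t with
  | zero =>
    intro i _ z hz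
    simp only [initialVariablesIdeal_zero, Ideal.mem_bot] at hz ⊢
    have hker : z ∈ LinearMap.ker (F.d i) := LinearMap.mem_ker.mpr (funext hz)
    rw [← F.exact_succ i] at hker
    obtain ⟨u, rfl⟩ := hker
    exact ⟨u, fun q => by simp⟩
  | succ t ih =>
    intro i hi z hz
    obtain ⟨i, rfl⟩ : ∃ m, i = m + 1 := ⟨i - 1, by omega⟩
    have htn : t < n := ht
    simp only [mem_initialVariablesIdeal_succ htn] at hz
    choose w g hg hzw using hz
    set x : PolyRing k n := MvPolynomial.X ⟨t, htn⟩ with hx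
    have hdz : F.d (i + 1) z = x • w + g := funext fun p => by
      rw [hzw p, mul_comm]
      rfl
    have hdw : ∀ p, F.d i w p ∈ initialVariablesIdeal k n t := by
      intro p
      refine mem_initialVariablesIdeal_of_mul_X htn ?_
      have h0 := congrFun (F.d_comp_d i z) p
      rw [hdz, map_add, map_smul, Pi.add_apply, Pi.smul_apply, smul_eq_mul, mul_comm] at h0
      rw [eq_neg_of_add_eq_zero_left h0]
      exact neg_mem (F.d_apply_mem hg p)
    obtain ⟨v, hv⟩ := ih htn.le i (by omega) w hdw
    obtain ⟨u, hu⟩ := ih htn.le (i + 1) (by omega) (z - x • v) (by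
      intro p
      have h1 : F.d (i + 1) (z - x • v) p = x * (w - F.d (i + 1) v) p + g p := by
        rw [map_sub, map_smul, hdz]
        simp only [Pi.sub_apply, Pi.add_apply, Pi.smul_apply, smul_eq_mul]
        ring
      rw [h1]
      exact Ideal.add_mem _ (Ideal.mul_mem_left _ _ (hv p)) (hg p))
    refine ⟨u, fun q => (mem_initialVariablesIdeal_succ htn _).mpr ⟨v q, _, hu q, ?_⟩⟩
    simp only [Pi.sub_apply, Pi.smul_apply, smul_eq_mul]
    ring

/-- `Tor_{i+1}(R / I, k) = 0` for `i + 1 > n`. -/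
theorem torDim_eq_zero_of_le {i : ℕ} (hi : n ≤ i) (b : Fin n → ℤ) : F.torDim i b = 0 := by
  rw [← torPiece_eq_bot_iff, torPiece, homologyPiece_eq_bot_iff]
  intro z _ hz
  obtain ⟨x, rfl⟩ := F.exists_tmul_one _ z
  obtain ⟨u, hu⟩ := F.exists_sub_d_mem_initialVariablesIdeal n le_rfl i hi x (by
    intro p
    have hz0 : F.torDifferential i (x ⊗ₜ 1) = 0 := hz
    rw [torDifferential, LinearMap.rTensor_tmul] at hz0
    rw [initialVariablesIdeal_self, mem_irrelevantIdeal_iff, ← torCoord_tmul, hz0, map_zero]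
    rfl)
  refine ⟨u ⊗ₜ 1, F.torCoord_injective _ (funext fun q => ?_)⟩
  have h := hu q
  rw [initialVariablesIdeal_self, mem_irrelevantIdeal_iff, Pi.sub_apply, map_sub, sub_eq_zero] at h
  rw [torDifferential, LinearMap.rTensor_tmul, torCoord_tmul, torCoord_tmul, h]

/-- The degrees in which some `Tor_{i+1}(R / I, k)` is nonzero have bounded total degree. -/
theorem exists_sum_le_of_torDim_ne_zero :
    ∃ B : ℕ, ∀ i b, F.torDim i b ≠ 0 → ∑ t, b t ≤ (B : ℤ) := by
  refine ⟨∑ i ∈ Finset.range n, ∑ q, (∑ t, F.deg (i + 1) q t).natAbs, fun i b h => ?_⟩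
  have hi : i < n := by
    by_contra hi
    exact h (F.torDim_eq_zero_of_le (not_lt.mp hi) b)
  have hcard : Fintype.card {q // F.deg (i + 1) q = b} ≠ 0 := by
    have := F.torDim_add i b
    omega
  obtain ⟨⟨q, rfl⟩⟩ := Fintype.card_pos_iff.mp (Nat.pos_of_ne_zero hcard)
  have h1 : (∑ t, F.deg (i + 1) q t).natAbs ≤ ∑ q, (∑ t, F.deg (i + 1) q t).natAbs :=
    Finset.single_le_sum (f := fun q => (∑ t, F.deg (i + 1) q t).natAbs)
      (fun _ _ => Nat.zero_le _) (Finset.mem_univ q)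
  have h2 : ∑ q, (∑ t, F.deg (i + 1) q t).natAbs
      ≤ ∑ i ∈ Finset.range n, ∑ q, (∑ t, F.deg (i + 1) q t).natAbs :=
    Finset.single_le_sum (f := fun i => ∑ q, (∑ t, F.deg (i + 1) q t).natAbs)
      (fun _ _ => Nat.zero_le _) (Finset.mem_range.mpr hi)
  omega

end MultigradedFreeResolution

/-! ### Rearrangements of partitions -/

section Rearrangement

variable {n : ℕ}

/-- A vector that dominates a rearrangement of a partition `lam` is a rearrangement of a partition
that dominates `lam`. -/
theorem exists_antitone_rearrangement {lam : Fin n → ℕ} (hlam : Antitone lam)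
    (σ : Equiv.Perm (Fin n)) {b : Fin n → ℤ} (hb : toIntVec (lam ∘ σ) ≤ b) :
    ∃ (mu : Fin n → ℕ) (τ : Equiv.Perm (Fin n)),
      Antitone mu ∧ b = toIntVec (mu ∘ τ) ∧ lam ≤ mu := by
  have hb0 : ∀ j, (lam (σ j) : ℤ) ≤ b j := hb
  let f : Fin n → ℕ := fun j => (b j).toNat
  let ρ : Equiv.Perm (Fin n) := Tuple.sort (OrderDual.toDual ∘ f)
  have hanti : Antitone (f ∘ ρ) := fun x y hxy => Tuple.monotone_sort (OrderDual.toDual ∘ f) hxy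
  refine ⟨f ∘ ρ, ρ.symm, hanti, funext fun j => ?_, fun t => ?_⟩
  · have := hb0 j
    simp only [toIntVec, Function.comp_apply, Equiv.apply_symm_apply, f]
    omega
  · -- Otherwise the positions `≤ t` of `lam` land among the positions `< t` of the sorted vector.
    by_contra hlt
    have hcard := Finset.card_le_card_of_injOn (s := Finset.Iic t) (t := Finset.Iio t)
      (fun s => ρ.symm (σ.symm s)) (fun s hs => by
        simp only [Finset.coe_Iic, Set.mem_Iic] at hs
        simp only [Finset.coe_Iio, Set.mem_Iio]
        by_contra hge
        have h1 := hanti (not_lt.mp hge)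
        have h2 := hb0 (σ.symm s)
        have h3 := hlam hs
        simp only [Function.comp_apply, Equiv.apply_symm_apply, f] at h1 h2 hlt
        omega)
      (fun x _ y _ hxy => by simpa using hxy)
    simp at hcard

theorem sum_toIntVec_comp (mu : Fin n → ℕ) (τ : Equiv.Perm (Fin n)) :
    ∑ t, toIntVec (mu ∘ τ) t = ∑ t, (mu t : ℤ) :=
  Equiv.sum_comp τ fun t => (mu t : ℤ)

theorem exists_antitone_rearrangement_of_lt {lam : Fin n → ℕ} (hlam : Antitone lam)
    (σ : Equiv.Perm (Fin n)) {b : Fin n → ℤ} (hb : toIntVec (lam ∘ σ) < b) :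
    ∃ (mu : Fin n → ℕ) (τ : Equiv.Perm (Fin n)),
      Antitone mu ∧ b = toIntVec (mu ∘ τ) ∧ lam < mu := by
  obtain ⟨mu, τ, hmu, rfl, hle⟩ := exists_antitone_rearrangement hlam σ hb.le
  refine ⟨mu, τ, hmu, rfl, lt_of_le_of_ne hle ?_⟩
  rintro rfl
  have h : ∑ t, toIntVec (lam ∘ σ) t < ∑ t, toIntVec (lam ∘ τ) t := Fintype.sum_strictMono hb
  rw [sum_toIntVec_comp, sum_toIntVec_comp] at h
  exact lt_irrefl _ h

end Rearrangement

namespace MultigradedFreeResolution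

variable {k : Type*} [Field k] {n : ℕ} {I : Ideal (PolyRing k n)} (F : MultigradedFreeResolution I)

/-! ### Extremal pairs -/

theorem torOrbitPiece_eq_bot_iff (i : ℕ) (lam : Fin n → ℕ) :
    F.torOrbitPiece (i + 1) lam = ⊥ ↔ ∀ σ : Equiv.Perm (Fin n),
      F.torDim i (toIntVec (lam ∘ σ)) = 0 := by
  simp only [torOrbitPiece, iSup_eq_bot, torPiece_eq_bot_iff]

theorem extOrbitPiece_eq_bot (i : ℕ) {lam : Fin n → ℕ} (hlam : Antitone lam)
    (h : ∀ mu, Antitone mu → lam ≤ mu → F.torOrbitPiece (i + 1) mu = ⊥) :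
    F.extOrbitPiece (i + 1) lam = ⊥ := by
  rw [extOrbitPiece, iSup_eq_bot]
  refine fun σ => F.extPiece_eq_bot i _ fun b hb => ?_
  obtain ⟨mu, τ, hmu, rfl, hle⟩ := exists_antitone_rearrangement hlam σ hb
  exact (F.torOrbitPiece_eq_bot_iff i mu).mp (h mu hmu hle) τ

theorem IsExtremal.rank_extPiece {F : MultigradedFreeResolution I} {i : ℕ} {lam : Fin n → ℕ}
    (h : F.IsExtremal (i + 1) lam) (hlam : Antitone lam) (σ : Equiv.Perm (Fin n)) :
    Module.rank k (F.extPiece (i + 1) (-toIntVec (lam ∘ σ)))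
      = Module.rank k (F.torPiece (i + 1) (toIntVec (lam ∘ σ))) := by
  have key : ∀ j, i ≤ j → j ≤ i + 1 → ∀ b, toIntVec (lam ∘ σ) < b → F.torDim j b = 0 := by
    intro j hij hji b hb
    obtain ⟨mu, τ, hmu, rfl, hlt⟩ := exists_antitone_rearrangement_of_lt hlam σ hb
    refine (F.torOrbitPiece_eq_bot_iff j mu).mp (h.2 (j + 1) mu (by omega) hmu hlt ?_) τ
    have hsum : ∑ t, lam t < ∑ t, mu t := Fintype.sum_strictMono hlt
    zify at hsum
    push_cast
    omega
  rw [F.rank_extPiece i _ (key i le_rfl (by omega)) (key (i + 1) (by omega) le_rfl),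
    F.rank_torPiece]

theorem IsExtremal.isExtExtremal {F : MultigradedFreeResolution I} {i : ℕ} {lam : Fin n → ℕ}
    (h : F.IsExtremal (i + 1) lam) (hlam : Antitone lam) : F.IsExtExtremal (i + 1) lam := by
  constructor
  · intro h0
    refine h.1 ?_
    rw [extOrbitPiece, iSup_eq_bot] at h0
    rw [torOrbitPiece, iSup_eq_bot]
    intro σ
    rw [← Submodule.rank_eq_zero, ← h.rank_extPiece hlam σ, h0 σ, Submodule.rank_eq_zero]
  · intro j mu hij hmu hlt hle
    obtain ⟨j, rfl⟩ : ∃ m, j = m + 1 := ⟨j - 1, by omega⟩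
    refine F.extOrbitPiece_eq_bot j hmu fun nu hnu hmunu => ?_
    refine h.2 (j + 1) nu hij hnu (hlt.trans_le hmunu) (hle.trans ?_)
    have hsum : ∑ t, mu t ≤ ∑ t, nu t := Finset.sum_le_sum fun t _ => hmunu t
    zify at hsum
    omega

/-- Every nonzero Betti number lies below an extremal one, since the degrees of nonzero Betti
numbers have bounded total degree. -/
theorem exists_isExtremal_ge {i : ℕ} {lam : Fin n → ℕ} (hlam : Antitone lam)
    (h : F.torOrbitPiece (i + 1) lam ≠ ⊥) :
    ∃ (j : ℕ) (mu : Fin n → ℕ), i ≤ j ∧ Antitone mu ∧ lam ≤ mu ∧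
      (∑ t, (lam t : ℤ)) - i ≤ (∑ t, (mu t : ℤ)) - j ∧ F.IsExtremal (j + 1) mu := by
  obtain ⟨B, hB⟩ := F.exists_sum_le_of_torDim_ne_zero
  induction hN : ((B : ℤ) - ∑ t, (lam t : ℤ)).toNat using Nat.strong_induction_on
    generalizing i lam with
  | _ N ih =>
    by_cases hext : F.IsExtremal (i + 1) lam
    · exact ⟨i, lam, le_rfl, hlam, le_rfl, le_rfl, hext⟩
    · have hnot := not_and.mp hext h
      push Not at hnot
      obtain ⟨j, mu, hij, hmu, hlt, hle, hne⟩ := hnot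
      obtain ⟨j, rfl⟩ : ∃ m, j = m + 1 := ⟨j - 1, by omega⟩
      have hbound : ∑ t, (mu t : ℤ) ≤ B := by
        have hne' := hne
        rw [Ne, torOrbitPiece_eq_bot_iff, not_forall] at hne'
        obtain ⟨σ, hσ⟩ := hne'
        have := hB j _ hσ
        rwa [sum_toIntVec_comp] at this
      have hsum : ∑ t, lam t < ∑ t, mu t := Fintype.sum_strictMono hlt
      zify at hsum
      obtain ⟨j', nu, hj, hnu, hmunu, hle', hex⟩ := ih _ (by omega) hmu hne rfl
      push_cast at hle
      exact ⟨j', nu, by omega, hnu, hlt.le.trans hmunu, by omega, hex⟩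

theorem IsExtExtremal.isExtremal {F : MultigradedFreeResolution I} {i : ℕ} {lam : Fin n → ℕ}
    (h : F.IsExtExtremal (i + 1) lam) (hlam : Antitone lam) : F.IsExtremal (i + 1) lam := by
  obtain ⟨nu, hnu, hle, hne⟩ : ∃ nu, Antitone nu ∧ lam ≤ nu ∧ F.torOrbitPiece (i + 1) nu ≠ ⊥ := by
    by_contra hcon
    push Not at hcon
    exact h.1 (F.extOrbitPiece_eq_bot i hlam hcon)
  obtain ⟨j, mu, hij, hmu, hnumu, hdeg, hex⟩ := F.exists_isExtremal_ge hnu hne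
  have hsum : ∑ t, lam t ≤ ∑ t, nu t := Finset.sum_le_sum fun t _ => hle t
  zify at hsum
  -- The extremal pair above `(i + 1, lam)` is `Ext`-extremal, so it can only be `(i + 1, lam)`.
  rcases (hle.trans hnumu).eq_or_lt with heq | hlt
  · obtain rfl : j = i := by
      rw [← heq] at hdeg
      omega
    rwa [heq]
  · refine absurd (h.2 (j + 1) mu (by omega) hmu hlt ?_) (hex.isExtExtremal hmu).1
    push_cast
    omega

end MultigradedFreeResolution
end

theorem mainTheorem7 {k : Type*} [Field k] {n : ℕ} (I : Ideal (PolyRing k n))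
    (hmon : IsMonomialIdeal I) (hsym : IsSymmetricIdeal I)
    (F : MultigradedFreeResolution I)
    (i : ℕ) (hi : 1 ≤ i) (hin : i ≤ n) (lam : Fin n → ℕ) (hlam : Antitone lam) :
    (F.IsExtremal i lam ↔ F.IsExtExtremal i lam) ∧
      (F.IsExtremal i lam →
        Module.rank k (F.torPiece i (toIntVec lam)) =
          Module.rank k (F.extPiece i (-toIntVec lam))) := by
  obtain ⟨i, rfl⟩ : ∃ m, i = m + 1 := ⟨i - 1, by omega⟩
  exact ⟨⟨fun h => h.isExtExtremal hlam, fun h => h.isExtremal hlam⟩,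
    fun h => (h.rank_extPiece hlam 1).symm⟩
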